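/- **Theorem.** Let $d\ge 1$. For each integer $n\ge 1$ let $\mathbb Z_n^d=(\mathbb Z/n\mathbb Z)^d$ be the discrete torus and let $\mathbb T^d=(\mathbb R/\mathbb Z)^d$. Let $(\sigma(x))_{x\in\mathbb Z_n^d}$ be centred jointly Gaussian random variables with $\mathbb E[\sigma(x)\sigma(y)]=K_n(x-y)$ for some function $K_n:\mathbb Z_n^d\to\mathbb R$ (for different $n$ they may live on different probability spaces), and consider the initial configuration $$s(x)=1+\sigma(x)-\frac1{n^d}\sum_{z\in\mathbb Z_n^d}\sigma(z),\qquad x\in\mathbb Z_n^d .$$ In the divisible sandpile, at each discrete time step every vertex $x$ with mass larger than $1$ keeps mass $1$ and distributes its excess uniformly among its $2d$ nearest neighbours $x\pm e_i$, all such vertices acting simultaneously. Let $u_n(x)$, the odometer, be the total mass emitted from $x$ during the whole evolution started from $s$. Put $\widehat{K_n}(\xi)=n^{-d}\sum_{z\in\mathbb Z_n^d}K_n(z)e^{-2\pi i z\cdot\xi/n}$ for $\xi\in\mathbb Z^d$ and assume that $$\sup_{n\ge1}\sup_{\xi\in\mathbb Z^d}\widehat{K_n}(\xi)<\infty\qquad\text{and}\qquad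 \widehat K(\xi):=\lim_{n\to\infty}\widehat{K_n}(\xi)\ \text{ exists and is }>0\text{ for every }\xi\in\mathbb Z^d .$$ For $a\in\mathbb R$ let $H^a_K(\mathbb T^d)$ be the real Hilbert space of formal Fourier series $g=\sum_{\xi\neq0}\widehat g(\xi)e^{2\pi i\xi\cdot x}$ with $\widehat g(-\xi)=\overline{\widehat g(\xi)}$ and $$\|g\|_{K,a}^2=\sum_{\xi\in\mathbb Z^d\setminus\{0\}}\widehat K(\xi)\,\|\xi\|^{4a}\,|\widehat g(\xi)|^2<\infty,$$ $\|\xi\|$ being the Euclidean norm; for $a<0$ this is the completion, with respect to $\|\cdot\|_{K,a}$, of the smooth real functions on $\mathbb T^d$ with mean zero (equivalently, modulo constants). Let $a_n=4\pi^2(2d)^{-1}n^{-2}$ and $$\Xi^K_n(x)=\sum_{z\in\mathbb Z_n^d}u_n(z)\,\mathbf 1_{B(z/n,\,1/(2n))}(x),\qquad x\in\mathbb T^d,$$ where $B(y,\rho)$ is the ball of centre $y$ and radius $\rho$ in the $\ell^\infty$-metric of $\mathbb T^d$. Let $\varepsilon>\max\{d/2,\,d/4+1\}$. Then $u_n$ is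 everywhere finite, $a_n\Xi^K_n$ (modulo constants) belongs to $H^{-\varepsilon}_K(\mathbb T^d)$, and, as $n\to\infty$, $a_n\Xi_n^K$ converges in law in $H_K^{-\varepsilon}(\mathbb T^d)$ to the Gaussian field $\Xi^K$. Here the law of $\Xi^K$ is the unique Gaussian probability measure on $H_K^{-\varepsilon}(\mathbb T^d)$ with characteristic functional $$\mathbb E\big[e^{i\langle\Xi^K,f\rangle}\big]=\exp\Big(-\frac12\sum_{\xi\in\mathbb Z^d\setminus\{0\}}\widehat K(\xi)\,\|\xi\|^{-4}\,|\widehat f(\xi)|^2\Big),\qquad f\in H_K^{-1}(\mathbb T^d),$$ where $\langle\Xi^K,f\rangle=\sum_{\xi\ne0}\widehat{\Xi^K}(\xi)\overline{\widehat f(\xi)}$ is the $L^2(\mathbb T^d)$-pairing, the series converging in mean square. -/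

import Mathlib

open MeasureTheory ProbabilityTheory Filter Topology

namespace Sandpile

/-! ### The divisible sandpile on the discrete torus -/

/-- The discrete torus `ℤ_n^d = (ℤ/nℤ)^d`. -/
abbrev DTorus (d n : ℕ) : Type := Fin d → ZMod n

/-- The initial configuration `s = 1 + σ - mean(σ)`. -/
noncomputable def initialConfig {d n : ℕ} [NeZero n] (σ : DTorus d n → ℝ) : DTorus d n → ℝ :=
  fun x => 1 + σ x - ((n : ℝ) ^ d)⁻¹ * ∑ z, σ z

/-- The mass emitted by the vertex `x` in one toppling of the configuration `s`: an unstable vertex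
(mass larger than `1`) keeps mass `1` and emits the excess. -/
noncomputable def emitted {d n : ℕ} (s : DTorus d n → ℝ) (x : DTorus d n) : ℝ :=
  max (s x - 1) 0

/-- One time step: all unstable vertices topple simultaneously, each of them distributing its excess
mass uniformly among its `2d` nearest neighbours `x ± e_i`. -/
noncomputable def topple {d n : ℕ} (s : DTorus d n → ℝ) : DTorus d n → ℝ := fun x =>
  s x - emitted s x +
    (2 * (d : ℝ))⁻¹ * ∑ i : Fin d, (emitted s (x + Pi.single i 1) + emitted s (x - Pi.single i 1))

/-- The odometer: the total mass emitted from each vertex during the whole evolution started from the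
configuration `s` (a priori it may be infinite). -/
noncomputable def odometer {d n : ℕ} (s : DTorus d n → ℝ) (x : DTorus d n) : ENNReal :=
  ∑' k : ℕ, ENNReal.ofReal (emitted (topple^[k] s) x)

/-! ### Fourier transform on the discrete torus and the interpolated field -/

/-- The discrete Fourier transform `f̂(ξ) = n^{-d} ∑_z f(z) exp(-2πi z·ξ/n)`, `ξ ∈ ℤ^d`; here
`ZMod.stdAddChar (j mod n) = exp(2πi j/n)`. -/
noncomputable def dft {d n : ℕ} [NeZero n] (f : DTorus d n → ℝ) (ξ : Fin d → ℤ) : ℂ :=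
  ((n : ℂ) ^ d)⁻¹ * ∑ z : DTorus d n, (f z : ℂ) * ZMod.stdAddChar (-∑ i, z i * (ξ i : ZMod n))

/-- The point `z / n` of the continuum torus `𝕋^d = (ℝ/ℤ)^d`. -/
noncomputable def toTorus {d n : ℕ} [NeZero n] (z : DTorus d n) : UnitAddTorus (Fin d) :=
  fun i => ZMod.toAddCircle (z i)

/-- The piecewise constant interpolation `x ↦ ∑_z u(z) 1_{B(z/n, 1/(2n))}(x)` on `𝕋^d`, with balls in
the `ℓ^∞`-metric of the torus. -/
noncomputable def interpolation {d n : ℕ} [NeZero n] (u : DTorus d n → ℝ) :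
    UnitAddTorus (Fin d) → ℝ := fun x =>
  ∑ z : DTorus d n, (Metric.ball (toTorus z) (1 / (2 * (n : ℝ)))).indicator (fun _ => u z) x

/-- The scaling factor `a_n = 4π² (2d)^{-1} n^{-2}`. -/
noncomputable def scaling (d n : ℕ) : ℝ := 4 * Real.pi ^ 2 * (2 * (d : ℝ))⁻¹ * ((n : ℝ) ^ 2)⁻¹

/-- The rescaled field `a_n Ξ_n^K` on `𝕋^d` built from the odometer of the weights `σ`. -/
noncomputable def scaledField {d n : ℕ} [NeZero n] (σ : DTorus d n → ℝ) :
    UnitAddTorus (Fin d) → ℝ := fun x =>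
  scaling d n * interpolation (fun z => (odometer (initialConfig σ) z).toReal) x

/-! ### The Sobolev spaces `H_K^a(𝕋^d)` -/

/-- The Euclidean norm of a frequency `ξ ∈ ℤ^d`. -/
noncomputable def freqNorm {d : ℕ} (ξ : Fin d → ℤ) : ℝ := Real.sqrt (∑ i, (ξ i : ℝ) ^ 2)

/-- The weight `K̂(ξ)^{1/2} ‖ξ‖^{2a}`. -/
noncomputable def weight {d : ℕ} (K : (Fin d → ℤ) → Set.Ioi (0 : ℝ)) (a : ℝ) (ξ : Fin d → ℤ) : ℝ :=
  Real.sqrt (K ξ : ℝ) * freqNorm ξ ^ (2 * a)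

/-- The real vector space of formal Fourier series `g` on `𝕋^d` that are real (`ĝ(-ξ)` is the conjugate
of `ĝ(ξ)`), have mean zero (`ĝ(0) = 0`) and satisfy `∑_{ξ ≠ 0} K̂(ξ) ‖ξ‖^{4a} |ĝ(ξ)|² < ∞`. -/
def sobolevSubmodule {d : ℕ} (K : (Fin d → ℤ) → Set.Ioi (0 : ℝ)) (a : ℝ) :
    Submodule ℝ ((Fin d → ℤ) → ℂ) where
  carrier := {g | g 0 = 0 ∧ (∀ ξ, g (-ξ) = (starRingEnd ℂ) (g ξ)) ∧
    Memℓp (fun ξ => weight K a ξ • g ξ) 2}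
  zero_mem' := by
    refine ⟨rfl, by simp, ?_⟩
    convert (zero_memℓp : Memℓp (0 : (Fin d → ℤ) → ℂ) 2) using 1
    funext ξ
    simp
  add_mem' := by
    rintro f g ⟨hf0, hf1, hf2⟩ ⟨hg0, hg1, hg2⟩
    refine ⟨by simp [hf0, hg0], by simp [hf1, hg1], ?_⟩
    have h := hf2.add hg2
    convert h using 1
    funext ξ
    simp
  smul_mem' := by
    rintro c f ⟨hf0, hf1, hf2⟩
    refine ⟨by simp [hf0], by simp [hf1], ?_⟩
    have h := hf2.const_smul c
    convert h using 1
    funext ξ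
    simp [mul_left_comm]

/-- The space `H_K^a(𝕋^d)`, the Hilbert space completion of the real-valued smooth functions on `𝕋^d`
with mean zero for the norm `‖f‖² = ∑_{ξ ≠ 0} K̂(ξ) ‖ξ‖^{4a} |f̂(ξ)|²`, realized as the space of all
real mean-zero Fourier series of finite norm. -/
def SobolevSpace {d : ℕ} (K : (Fin d → ℤ) → Set.Ioi (0 : ℝ)) (a : ℝ) : Type :=
  sobolevSubmodule K a

namespace SobolevSpace

variable {d : ℕ} {K : (Fin d → ℤ) → Set.Ioi (0 : ℝ)} {a : ℝ}

noncomputable instance : AddCommGroup (SobolevSpace K a) :=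
  inferInstanceAs (AddCommGroup (sobolevSubmodule K a))

noncomputable instance : Module ℝ (SobolevSpace K a) :=
  inferInstanceAs (Module ℝ (sobolevSubmodule K a))

/-- The Fourier coefficient `ĝ(ξ)` of an element of `H_K^a`. -/
def coeff (g : SobolevSpace K a) (ξ : Fin d → ℤ) : ℂ := g.1 ξ

/-- The map `g ↦ (K̂(ξ)^{1/2} ‖ξ‖^{2a} ĝ(ξ))_ξ` into `ℓ²(ℤ^d)`, through which the norm is defined. -/
noncomputable def toL2 : SobolevSpace K a →ₗ[ℝ] lp (fun _ : Fin d → ℤ => ℂ) 2 where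
  toFun g := ⟨fun ξ => weight K a ξ • g.coeff ξ, g.2.2.2⟩
  map_add' f g := by
    apply Subtype.ext
    funext ξ
    exact smul_add (weight K a ξ) (f.coeff ξ) (g.coeff ξ)
  map_smul' c g := by
    apply Subtype.ext
    funext ξ
    exact smul_comm (weight K a ξ) c (g.coeff ξ)

theorem freqNorm_pos {ξ : Fin d → ℤ} (h : ξ ≠ 0) : 0 < freqNorm ξ := by
  obtain ⟨i, hi⟩ := Function.ne_iff.mp h
  have hi' : (ξ i : ℝ) ≠ 0 := by exact_mod_cast hi
  exact Real.sqrt_pos.mpr (Finset.sum_pos' (fun j _ => sq_nonneg _)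
    ⟨i, Finset.mem_univ i, by positivity⟩)

theorem weight_pos {ξ : Fin d → ℤ} (h : ξ ≠ 0) : 0 < weight K a ξ :=
  mul_pos (Real.sqrt_pos.mpr (K ξ).2) (Real.rpow_pos_of_pos (freqNorm_pos h) _)

theorem toL2_injective : Function.Injective (toL2 : SobolevSpace K a →ₗ[ℝ] _) := by
  intro f g h
  apply Subtype.ext
  funext ξ
  by_cases hξ : ξ = 0
  · rw [hξ, f.2.1, g.2.1]
  · have h1 : weight K a ξ • f.coeff ξ = weight K a ξ • g.coeff ξ :=
      congrFun (congrArg Subtype.val h) ξ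
    exact smul_right_injective ℂ (weight_pos hξ).ne' h1

noncomputable instance : NormedAddCommGroup (SobolevSpace K a) :=
  NormedAddCommGroup.induced (SobolevSpace K a) (lp (fun _ : Fin d → ℤ => ℂ) 2) toL2 toL2_injective

noncomputable instance : NormedSpace ℝ (SobolevSpace K a) :=
  NormedSpace.induced ℝ (SobolevSpace K a) (lp (fun _ : Fin d → ℤ => ℂ) 2) toL2

noncomputable instance : MeasurableSpace (SobolevSpace K a) := borel _

instance : BorelSpace (SobolevSpace K a) := ⟨rfl⟩

/-- The norm is the one of the definition (the term `ξ = 0` vanishes). -/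
theorem norm_sq_eq (g : SobolevSpace K a) :
    ‖g‖ ^ 2 = ∑' ξ, (K ξ : ℝ) * freqNorm ξ ^ (4 * a) * ‖g.coeff ξ‖ ^ 2 := by
  have h := lp.norm_rpow_eq_tsum (p := 2) (by norm_num) (toL2 g)
  have h' : ‖toL2 g‖ ^ 2 = ∑' ξ, ‖toL2 g ξ‖ ^ 2 := by exact_mod_cast h
  refine h'.trans (tsum_congr fun ξ => ?_)
  have h0 : 0 ≤ freqNorm ξ := Real.sqrt_nonneg _
  change ‖weight K a ξ • g.coeff ξ‖ ^ 2 = _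
  rw [norm_smul, mul_pow, Real.norm_eq_abs, sq_abs, weight, mul_pow, Real.sq_sqrt (K ξ).2.le,
    ← Real.rpow_natCast, ← Real.rpow_mul h0]
  congr 3
  push_cast
  ring

/-- `g ∈ H_K^a` is the class, modulo constants, of the function `F` on the torus: it has the same
Fourier coefficients `F̂(ξ) = ∫_{𝕋^d} F(x) exp(-2πi ξ·x) dx` at all `ξ ≠ 0`. -/
def Represents (g : SobolevSpace K a) (F : UnitAddTorus (Fin d) → ℝ) : Prop :=
  ∀ ξ : Fin d → ℤ, ξ ≠ 0 →
    g.coeff ξ = UnitAddTorus.mFourierCoeff (fun x => (F x : ℂ)) ξ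

end SobolevSpace

/-! ### The limiting field -/

/-- `Y` is the `L²(𝕋^d)`-pairing `g ↦ ⟨g, f⟩ = ∑_ξ ĝ(ξ) conj f̂(ξ)` of a random element of `H_K^a` with
law `μ` and the test function `f`, the series being convergent (unconditionally) in `L²(μ)`. -/
def IsPairing {d : ℕ} {K : (Fin d → ℤ) → Set.Ioi (0 : ℝ)} {a : ℝ} (μ : Measure (SobolevSpace K a))
    (f : SobolevSpace K (-1)) (Y : SobolevSpace K a → ℝ) : Prop :=
  Measurable Y ∧
  Tendsto (fun S : Finset (Fin d → ℤ) =>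
      eLpNorm (fun g : SobolevSpace K a =>
        (∑ ξ ∈ S, g.coeff ξ * (starRingEnd ℂ) (f.coeff ξ)) - (Y g : ℂ)) 2 μ)
    atTop (𝓝 0)

/-- `μ` is the law on `H_K^a` of the field `Ξ^K`: a Gaussian measure with characteristic functional
`E[exp(i⟨Ξ^K, f⟩)] = exp(-‖f‖²/2)`, where `f ∈ H_K^{-1}` and
`‖f‖² = ∑_{ξ ≠ 0} K̂(ξ) ‖ξ‖^{-4} |f̂(ξ)|²` is the squared norm of `H_K^{-1}`. -/
structure IsLimitLaw {d : ℕ} {K : (Fin d → ℤ) → Set.Ioi (0 : ℝ)} {a : ℝ}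
    (μ : Measure (SobolevSpace K a)) : Prop where
  isGaussian : IsGaussian μ
  charFunctional : ∀ f : SobolevSpace K (-1), ∃ Y : SobolevSpace K a → ℝ, IsPairing μ f Y ∧
    ∫ g, Complex.exp (Complex.I * (Y g : ℂ)) ∂μ = (Real.exp (-‖f‖ ^ 2 / 2) : ℂ)

end Sandpile

open Sandpile

/-!
The odometer solves a Poisson equation. Write `Δ` for the normalized Laplacian (`lap`). Since
`s - 1` has total mass zero, there is `w ≥ 0` with `s + Δ w ≤ 1`, and by the least action principle
(`sum_emitted_le`) the mass emitted up to any time is at most `w`; so the odometer `u` is finite, and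
passing to the limit in `s_k = s + Δ u_k` gives `s + Δ u = 1` (`lap_odometer`): the limit is at most
`1` everywhere and its mean is `1`. Hence the Fourier coefficient of `a_n Ξ_n` at `ξ ≠ 0` is
`m_n(ξ) σ̂(ξ)`, where the multiplier `m_n(ξ)` is `a_n` divided by the eigenvalue of `-Δ` times the
Fourier transform of a cell (`mFourierCoeff_scaledField`). The elementary bounds on `1 - cos` give
`|m_n(ξ)| ≤ π²/4` and `m_n(ξ) → ‖ξ‖⁻²` (`norm_multiplier_le`, `tendsto_multiplier`); frequencies that
vanish modulo `n` do no harm, for there the transform of the cell is zero.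

So `a_n Ξ_n` is a continuous linear image (`fieldMap`) of the Gaussian vector `σ`, its coefficients
have second moments bounded uniformly in `n` and `ξ`, and by stationarity its covariances converge:
`E[m_n(ξ) σ̂(ξ) conj(m_n(η) σ̂(η))] → K̂(ξ) ‖ξ‖⁻⁴ 1_{ξ = η}`. The bound on the second moments and
`ε > d/2` give tightness, as Hilbert cubes are compact (`isTightMeasureSet_of_lintegral_le`). Every
limit point, taken along an ultrafilter by Prokhorov's theorem, is Gaussian
(`isGaussian_of_tendsto_charFunDual`), and its pairing with a trigonometric polynomial `φ` is centred
of variance `‖φ‖²` in `H_K^{-1}` (`HasFieldMarginals`). These marginals determine the law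
(`HasFieldMarginals.eq`), so all limit points agree and the sequence converges. They also provide the
characteristic functional on all of `H_K^{-1}`: the pairing is isometric from trigonometric polynomials
to `L²`, hence extends to their closure (`HasFieldMarginals.exists_isPairing`). Conversely, a law with
that functional has these marginals (`IsLimitLaw.hasFieldMarginals`), which gives uniqueness.
-/

namespace Sandpile

/-! ### The odometer of the divisible sandpile -/

variable {d n : ℕ}

/-- The normalized graph Laplacian of the discrete torus, `(lap f)(x)` being the average of `f` over
the `2d` neighbours of `x` (with multiplicity) minus `f x`. -/
noncomputable def lap (d n : ℕ) : (DTorus d n → ℝ) →ₗ[ℝ] (DTorus d n → ℝ) where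
  toFun f x := (2 * (d : ℝ))⁻¹ * ∑ i : Fin d, (f (x + Pi.single i 1) + f (x - Pi.single i 1)) - f x
  map_add' f g := by
    funext x
    simp only [Pi.add_apply, Finset.sum_add_distrib]
    ring
  map_smul' c f := by
    funext x
    simp only [Pi.smul_apply, smul_eq_mul, Finset.sum_add_distrib, ← Finset.mul_sum,
      RingHom.id_apply]
    ring

theorem lap_apply (f : DTorus d n → ℝ) (x : DTorus d n) : lap d n f x =
    (2 * (d : ℝ))⁻¹ * ∑ i : Fin d, (f (x + Pi.single i 1) + f (x - Pi.single i 1)) - f x := rfl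

theorem lap_const (hd : 1 ≤ d) (c : ℝ) : lap d n (fun _ => c) = 0 := by
  funext x
  have : (d : ℝ) ≠ 0 := by positivity
  simp only [lap_apply, Finset.sum_const, Finset.card_univ, Fintype.card_fin, nsmul_eq_mul,
    Pi.zero_apply]
  field_simp
  ring

theorem topple_eq (s : DTorus d n → ℝ) : topple s = s + lap d n (emitted s) := by
  funext x
  simp only [topple, Pi.add_apply, lap_apply]
  ring

/-- After `k` steps the configuration is `s + Δ u_k`, where `u_k` is the mass emitted so far. -/
theorem topple_iterate (s : DTorus d n → ℝ) (k : ℕ) :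
    topple^[k] s = s + lap d n (∑ j ∈ Finset.range k, emitted (topple^[j] s)) := by
  induction k with
  | zero => simp
  | succ k ih =>
    rw [Function.iterate_succ_apply', topple_eq, Finset.sum_range_succ, map_add, ← add_assoc, ← ih]

theorem emitted_nonneg (s : DTorus d n → ℝ) (x : DTorus d n) : 0 ≤ emitted s x := le_max_right _ _

/-- The least action principle: the mass emitted up to time `k` is dominated by every nonnegative
function `w` such that toppling according to `w` stabilizes `s`. -/
theorem sum_emitted_le (s w : DTorus d n → ℝ) (hw : 0 ≤ w) (hs : s + lap d n w ≤ 1) (k : ℕ) :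
    ∑ j ∈ Finset.range k, emitted (topple^[j] s) ≤ w := by
  induction k with
  | zero => simpa using hw
  | succ k ih =>
    intro x
    rw [Finset.sum_range_succ, Pi.add_apply]
    set u := ∑ j ∈ Finset.range k, emitted (topple^[j] s) with hu
    have hx : topple^[k] s x = s x + lap d n u x := by rw [topple_iterate]; rfl
    rcases le_total (topple^[k] s x) 1 with h | h
    · have : emitted (topple^[k] s) x = 0 := max_eq_right (by linarith)
      rw [this, add_zero]
      exact ih x
    · have h1 : emitted (topple^[k] s) x = topple^[k] s x - 1 := max_eq_left (by linarith)
      have h2 := hs x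
      simp only [Pi.add_apply, Pi.one_apply, lap_apply] at h2
      rw [h1, hx, lap_apply]
      have h3 : (2 * (d : ℝ))⁻¹ * ∑ i : Fin d, (u (x + Pi.single i 1) + u (x - Pi.single i 1)) ≤
          (2 * (d : ℝ))⁻¹ * ∑ i : Fin d, (w (x + Pi.single i 1) + w (x - Pi.single i 1)) := by
        gcongr with i
        · exact ih _
        · exact ih _
      linarith

variable [NeZero n]

theorem sum_lap (hd : 1 ≤ d) (f : DTorus d n → ℝ) : ∑ x, lap d n f x = 0 := by
  have hd' : (d : ℝ) ≠ 0 := by positivity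
  simp only [lap_apply, Finset.sum_sub_distrib, ← Finset.mul_sum]
  rw [Finset.sum_comm]
  have h (i : Fin d) : ∑ x : DTorus d n, (f (x + Pi.single i 1) + f (x - Pi.single i 1))
      = 2 * ∑ x, f x := by
    have h1 := Equiv.sum_comp (Equiv.addRight (Pi.single i 1 : DTorus d n)) f
    have h2 := Equiv.sum_comp (Equiv.subRight (Pi.single i 1 : DTorus d n)) f
    simp only [Equiv.coe_addRight, Equiv.subRight_apply] at h1 h2
    rw [Finset.sum_add_distrib, h1, h2, two_mul]
  simp only [h, Finset.sum_const, Finset.card_univ, Fintype.card_fin, nsmul_eq_mul]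
  field_simp
  ring

/-- The Dirichlet form of the discrete torus. -/
theorem sum_mul_lap (hd : 1 ≤ d) (f : DTorus d n → ℝ) : ∑ x, f x * lap d n f x =
    -((2 * (d : ℝ))⁻¹ * ∑ i : Fin d, ∑ x, (f (x + Pi.single i 1) - f x) ^ 2) := by
  have hd' : (d : ℝ) ≠ 0 := by positivity
  have h (i : Fin d) : ∑ x : DTorus d n, (f (x + Pi.single i 1) - f x) ^ 2
      = 2 * ∑ x, f x ^ 2 - ∑ x, f x * (f (x + Pi.single i 1) + f (x - Pi.single i 1)) := by
    have h1 := Equiv.sum_comp (Equiv.addRight (Pi.single i 1 : DTorus d n)) (fun x => f x ^ 2)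
    have h2 := Equiv.sum_comp (Equiv.addRight (Pi.single i 1 : DTorus d n))
      (fun x => f x * f (x - Pi.single i 1))
    simp only [Equiv.coe_addRight, add_sub_cancel_right] at h1 h2
    simp only [sub_sq, mul_add, Finset.sum_add_distrib, Finset.sum_sub_distrib, h1, ← h2]
    have h3 : ∑ x : DTorus d n, 2 * f (x + Pi.single i 1) * f x
        = 2 * ∑ x, f (x + Pi.single i 1) * f x := by
      rw [Finset.mul_sum]; exact Finset.sum_congr rfl fun _ _ => by ring
    have h4 : ∑ x : DTorus d n, f x * f (x + Pi.single i 1)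
        = ∑ x, f (x + Pi.single i 1) * f x := Finset.sum_congr rfl fun _ _ => by ring
    rw [h3, h4]
    ring
  simp only [h, Finset.sum_sub_distrib, Finset.sum_const, Finset.card_univ, Fintype.card_fin,
    nsmul_eq_mul, lap_apply, mul_sub]
  rw [Finset.sum_comm (s := (Finset.univ : Finset (Fin d)))]
  have h5 : ∑ x : DTorus d n, f x * ((2 * (d : ℝ))⁻¹ *
      ∑ i : Fin d, (f (x + Pi.single i 1) + f (x - Pi.single i 1))) =
      (2 * (d : ℝ))⁻¹ * ∑ x : DTorus d n,
        ∑ i : Fin d, f x * (f (x + Pi.single i 1) + f (x - Pi.single i 1)) := by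
    rw [Finset.mul_sum]
    refine Finset.sum_congr rfl fun x _ => ?_
    rw [← Finset.mul_sum]
    ring
  have h6 : ∑ x : DTorus d n, f x * f x = ∑ x, f x ^ 2 :=
    Finset.sum_congr rfl fun _ _ => by ring
  rw [h5, h6]
  field_simp
  ring

/-- Harmonic functions on the (connected) discrete torus are constant. -/
theorem eq_of_lap_eq_zero (hd : 1 ≤ d) {f : DTorus d n → ℝ} (hf : lap d n f = 0)
    (x y : DTorus d n) : f x = f y := by
  have h0 := sum_mul_lap hd f
  rw [hf] at h0
  simp only [Pi.zero_apply, mul_zero, Finset.sum_const_zero] at h0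
  have hd' : (0 : ℝ) < (2 * (d : ℝ))⁻¹ := by
    have : (0 : ℝ) < d := by exact_mod_cast hd
    positivity
  have h1 : ∑ i : Fin d, ∑ x, (f (x + Pi.single i 1) - f x) ^ 2 = 0 := by
    have := zero_eq_neg.mp h0
    exact (mul_eq_zero.mp this).resolve_left hd'.ne'
  have hstep (i : Fin d) (x : DTorus d n) : f (x + Pi.single i 1) = f x := by
    have h2 := (Finset.sum_eq_zero_iff_of_nonneg
      (fun i _ => Finset.sum_nonneg fun x _ => sq_nonneg _)).mp h1 i (Finset.mem_univ i)
    have h3 := (Finset.sum_eq_zero_iff_of_nonneg (fun x _ => sq_nonneg _)).mp h2 x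
      (Finset.mem_univ x)
    exact sub_eq_zero.mp (pow_eq_zero_iff two_ne_zero |>.mp h3)
  have hmul (i : Fin d) (k : ℕ) (x : DTorus d n) :
      f (x + k • Pi.single i (1 : ZMod n)) = f x := by
    induction k with
    | zero => simp
    | succ k ih => rw [succ_nsmul, ← add_assoc, hstep, ih]
  have hsum (S : Finset (Fin d)) (z x : DTorus d n) :
      f (x + ∑ i ∈ S, Pi.single i (z i)) = f x := by
    induction S using Finset.induction_on generalizing x with
    | empty => simp
    | insert i S hi ih =>
      rw [Finset.sum_insert hi, ← add_assoc, ih]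
      have : Pi.single i (z i) = (z i).val • (Pi.single i (1 : ZMod n) : DTorus d n) := by
        rw [← Pi.single_smul]
        simp
      rw [this, hmul]
  have := hsum Finset.univ (x - y) y
  rwa [Finset.univ_sum_single, add_sub_cancel] at this

/-- The Poisson equation on the discrete torus is solvable for every right-hand side of mean zero. -/
theorem exists_lap_eq (hd : 1 ≤ d) {h : DTorus d n → ℝ} (hh : ∑ x, h x = 0) :
    ∃ f, lap d n f = h := by
  let A : (DTorus d n → ℝ) →ₗ[ℝ] (DTorus d n → ℝ) :=
    { toFun := fun f => lap d n f - fun _ => ∑ x, f x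
      map_add' := fun f g => by
        funext x
        simp [Finset.sum_add_distrib]
        ring
      map_smul' := fun c f => by
        funext x
        simp [← Finset.mul_sum]
        ring }
  have hA (f : DTorus d n → ℝ) : ∑ x, A f x = -((Fintype.card (DTorus d n) : ℝ) * ∑ x, f x) := by
    change ∑ x, (lap d n f x - ∑ x, f x) = _
    rw [Finset.sum_sub_distrib, sum_lap hd]
    simp
  have hN : (Fintype.card (DTorus d n) : ℝ) ≠ 0 := by positivity
  have hz (f : DTorus d n → ℝ) (hf : ∑ x, A f x = 0) : ∑ x, f x = 0 := by
    rw [hA, neg_eq_zero] at hf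
    exact (mul_eq_zero.mp hf).resolve_left hN
  have hAl (f : DTorus d n → ℝ) (hf : ∑ x, f x = 0) : A f = lap d n f := by
    funext x
    change lap d n f x - ∑ x, f x = _
    rw [hf, sub_zero]
  have hinj : Function.Injective A := by
    rw [← LinearMap.ker_eq_bot, LinearMap.ker_eq_bot']
    intro f hf
    have h0 := hz f (by simp [hf])
    rw [hAl f h0] at hf
    funext x
    have h1 : ∑ y, f y = ∑ y : DTorus d n, f x :=
      Finset.sum_congr rfl fun y _ => eq_of_lap_eq_zero hd hf y x
    rw [h0, Finset.sum_const, Finset.card_univ, nsmul_eq_mul] at h1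
    exact (mul_eq_zero.mp h1.symm).resolve_left hN
  obtain ⟨f, hf⟩ := LinearMap.injective_iff_surjective.mp hinj h
  exact ⟨f, by rw [← hf, hAl f (hz f (by rw [hf, hh]))]⟩

theorem summable_emitted (hd : 1 ≤ d) {s : DTorus d n → ℝ} (hs : ∑ x, (s x - 1) = 0)
    (x : DTorus d n) : Summable fun k => emitted (topple^[k] s) x := by
  obtain ⟨f, hf⟩ := exists_lap_eq hd (h := fun x => 1 - s x) (by
    rw [← neg_eq_zero, ← Finset.sum_neg_distrib, ← hs]
    exact Finset.sum_congr rfl fun _ _ => by ring)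
  -- adding a constant makes the solution of the Poisson equation nonnegative
  obtain ⟨c, hc⟩ := (Set.finite_range f).bddBelow
  let w : DTorus d n → ℝ := f + fun _ => -c
  have hw : 0 ≤ w := fun y => by
    have : c ≤ f y := hc ⟨y, rfl⟩
    simp only [w, Pi.add_apply, Pi.zero_apply]
    linarith
  have hlw : s + lap d n w ≤ 1 := by
    rw [map_add, lap_const hd, add_zero, hf]
    intro y
    simp
  refine summable_of_sum_range_le (c := w x) (fun k => emitted_nonneg _ _) fun k => ?_
  have := sum_emitted_le s w hw hlw k x
  rwa [Finset.sum_apply] at this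

theorem odometer_ne_top (hd : 1 ≤ d) {s : DTorus d n → ℝ} (hs : ∑ x, (s x - 1) = 0)
    (x : DTorus d n) : odometer s x ≠ ⊤ := by
  rw [odometer]
  exact (summable_emitted hd hs x).tsum_ofReal_ne_top

/-- The odometer solves the Poisson equation `Δ u = 1 - s`: the sandpile of total mass `n^d`
stabilizes to the constant configuration `1`. -/
theorem lap_odometer (hd : 1 ≤ d) {s : DTorus d n → ℝ} (hs : ∑ x, (s x - 1) = 0) :
    lap d n (fun x => (odometer s x).toReal) = fun x => 1 - s x := by
  set u : DTorus d n → ℝ := fun x => (odometer s x).toReal with hu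
  have hsum (x : DTorus d n) : HasSum (fun k => emitted (topple^[k] s) x) (u x) := by
    have : u x = ∑' k, emitted (topple^[k] s) x := by
      simp only [hu, odometer]
      rw [← ENNReal.ofReal_tsum_of_nonneg (fun k => emitted_nonneg _ _) (summable_emitted hd hs x),
        ENNReal.toReal_ofReal (tsum_nonneg fun k => emitted_nonneg _ _)]
    rw [this]
    exact (summable_emitted hd hs x).hasSum
  have hlim : Tendsto (fun k => topple^[k] s) atTop (𝓝 (s + lap d n u)) := by
    have h1 : Tendsto (fun k => ∑ j ∈ Finset.range k, emitted (topple^[j] s)) atTop (𝓝 u) := by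
      rw [tendsto_pi_nhds]
      intro x
      simpa only [Finset.sum_apply] using (hsum x).tendsto_sum_nat
    have h2 : Continuous (lap d n) := LinearMap.continuous_of_finiteDimensional _
    exact (tendsto_const_nhds.add ((h2.tendsto u).comp h1)).congr fun k =>
      (topple_iterate s k).symm
  -- the emitted mass tends to `0`, so the limit configuration has no unstable vertex
  have hle (x : DTorus d n) : s x + lap d n u x ≤ 1 := by
    have h1 : Tendsto (fun k => emitted (topple^[k] s) x) atTop
        (𝓝 (max (s x + lap d n u x - 1) 0)) :=
      (((tendsto_pi_nhds.mp hlim x).sub_const 1).max tendsto_const_nhds)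
    have h2 := tendsto_nhds_unique h1 (hsum x).summable.tendsto_atTop_zero
    have := max_eq_right_iff.mp h2
    linarith
  have hz : ∑ x, (1 - (s x + lap d n u x)) = 0 := by
    have : ∑ x, (1 - (s x + lap d n u x)) = -(∑ x, (s x - 1)) - ∑ x, lap d n u x := by
      rw [← Finset.sum_neg_distrib, ← Finset.sum_sub_distrib]
      exact Finset.sum_congr rfl fun _ _ => by ring
    rw [this, hs, sum_lap hd]
    simp
  funext x
  have := (Finset.sum_eq_zero_iff_of_nonneg (fun y _ => sub_nonneg.mpr (hle y))).mp hz x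
    (Finset.mem_univ x)
  linarith

theorem sum_initialConfig (σ : DTorus d n → ℝ) : ∑ x, (initialConfig σ x - 1) = 0 := by
  have hn : ((n : ℝ) ^ d) ≠ 0 := pow_ne_zero _ (NeZero.ne _)
  simp only [initialConfig]
  have : ∀ x, 1 + σ x - ((n : ℝ) ^ d)⁻¹ * ∑ z, σ z - 1 = σ x - ((n : ℝ) ^ d)⁻¹ * ∑ z, σ z :=
    fun x => by ring
  simp only [this, Finset.sum_sub_distrib, Finset.sum_const, Finset.card_univ, Fintype.card_pi,
    ZMod.card, Finset.prod_const, Fintype.card_fin, nsmul_eq_mul, Nat.cast_pow]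
  field_simp
  ring

end Sandpile

namespace Sandpile

/-! ### Discrete Fourier transform of the odometer -/

section DiscreteFourier

variable {d n : ℕ} [NeZero n]

theorem conj_stdAddChar (j : ZMod n) :
    (starRingEnd ℂ) (ZMod.stdAddChar j) = ZMod.stdAddChar (-j) := by
  rw [ZMod.stdAddChar_apply, ZMod.stdAddChar_apply, ← Circle.coe_inv_eq_conj, AddChar.map_neg_eq_inv]

theorem stdAddChar_sum {ι : Type*} [Fintype ι] (f : ι → ZMod n) :
    (ZMod.stdAddChar (∑ i, f i) : ℂ) = ∏ i, ZMod.stdAddChar (f i) :=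
  map_prod (ZMod.stdAddChar (N := n)).toMonoidHom (fun i => Multiplicative.ofAdd (f i)) _

/-- Orthogonality of characters on the discrete torus. -/
theorem sum_stdAddChar (ξ : Fin d → ZMod n) :
    ∑ z : DTorus d n, (ZMod.stdAddChar (∑ i, z i * ξ i) : ℂ) = if ξ = 0 then (n : ℂ) ^ d else 0 := by
  have h1 : ∑ z : DTorus d n, (ZMod.stdAddChar (∑ i, z i * ξ i) : ℂ)
      = ∏ i : Fin d, ∑ j : ZMod n, (ZMod.stdAddChar (j * ξ i) : ℂ) := by
    rw [Finset.prod_univ_sum, Fintype.piFinset_univ]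
    exact Finset.sum_congr rfl fun z _ => stdAddChar_sum _
  rw [h1]
  have h2 (i : Fin d) : ∑ j : ZMod n, (ZMod.stdAddChar (j * ξ i) : ℂ)
      = if ξ i = 0 then (n : ℂ) else 0 := by
    rw [AddChar.sum_mulShift _ (ZMod.isPrimitive_stdAddChar n), ZMod.card]
    split_ifs <;> simp
  simp only [h2]
  split_ifs with h
  · simp [h]
  · obtain ⟨i, hi⟩ := Function.ne_iff.mp h
    exact Finset.prod_eq_zero (Finset.mem_univ i) (if_neg hi)

/-- The reduction modulo `n` of a frequency. -/
def redFreq (n : ℕ) (ξ : Fin d → ℤ) : Fin d → ZMod n := fun i => (ξ i : ZMod n)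

theorem dft_def (f : DTorus d n → ℝ) (ξ : Fin d → ℤ) : dft f ξ =
    ((n : ℂ) ^ d)⁻¹ * ∑ z : DTorus d n, (f z : ℂ) * ZMod.stdAddChar (-∑ i, z i * redFreq n ξ i) := rfl

theorem dft_add (f g : DTorus d n → ℝ) (ξ : Fin d → ℤ) :
    dft (f + g) ξ = dft f ξ + dft g ξ := by
  simp only [dft_def, Pi.add_apply, Complex.ofReal_add, add_mul, Finset.sum_add_distrib, mul_add]

theorem dft_smul (c : ℝ) (f : DTorus d n → ℝ) (ξ : Fin d → ℤ) :
    dft (c • f) ξ = c * dft f ξ := by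
  simp only [dft_def, Pi.smul_apply, smul_eq_mul, Complex.ofReal_mul, Finset.mul_sum]
  exact Finset.sum_congr rfl fun _ _ => by ring

theorem dft_neg_freq (f : DTorus d n → ℝ) (ξ : Fin d → ℤ) :
    dft f (-ξ) = (starRingEnd ℂ) (dft f ξ) := by
  have h : redFreq n (-ξ) = -redFreq n ξ := by
    funext i
    simp [redFreq]
  simp only [dft_def, map_mul, map_sum, map_inv₀, map_pow, Complex.conj_ofReal, Complex.conj_natCast,
    conj_stdAddChar, h, Pi.neg_apply, mul_neg, Finset.sum_neg_distrib]

theorem dft_const (c : ℝ) (ξ : Fin d → ℤ) :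
    dft (fun _ : DTorus d n => c) ξ = if redFreq n ξ = 0 then (c : ℂ) else 0 := by
  have h := sum_stdAddChar (-redFreq n ξ)
  have hn : ((n : ℂ) ^ d) ≠ 0 := pow_ne_zero _ (NeZero.ne _)
  simp only [Pi.neg_apply, mul_neg, Finset.sum_neg_distrib, neg_eq_zero] at h
  rw [dft_def, ← Finset.mul_sum, h]
  split_ifs
  · field_simp
  · simp

theorem dft_translate (f : DTorus d n → ℝ) (a : DTorus d n) (ξ : Fin d → ℤ) :
    dft (fun x => f (x + a)) ξ = ZMod.stdAddChar (∑ i, a i * redFreq n ξ i) * dft f ξ := by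
  simp only [dft_def]
  have h := Equiv.sum_comp (Equiv.addRight a) (fun z : DTorus d n => (f z : ℂ) *
    (ZMod.stdAddChar (-∑ i : Fin d, (z i - a i) * redFreq n ξ i) : ℂ))
  simp only [Equiv.coe_addRight, Pi.add_apply, add_sub_cancel_right] at h
  rw [h, mul_left_comm]
  refine congrArg _ ?_
  rw [Finset.mul_sum]
  refine Finset.sum_congr rfl fun z _ => ?_
  have : -∑ i, (z i - a i) * redFreq n ξ i
      = ∑ i, a i * redFreq n ξ i + -∑ i, z i * redFreq n ξ i := by
    simp only [sub_mul, Finset.sum_sub_distrib]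
    ring
  rw [this, AddChar.map_add_eq_mul]
  ring

/-- The eigenvalue of `-Δ` on the discrete torus for the character of frequency `ξ`. -/
noncomputable def eigenvalue (n : ℕ) (ξ : Fin d → ℤ) : ℝ :=
  (d : ℝ)⁻¹ * ∑ i, (1 - Real.cos (2 * Real.pi * ξ i / n))

theorem stdAddChar_add_neg (j : ℤ) :
    (ZMod.stdAddChar (j : ZMod n) : ℂ) + ZMod.stdAddChar (-(j : ZMod n))
      = ((2 * Real.cos (2 * Real.pi * j / n) : ℝ) : ℂ) := by
  rw [← Int.cast_neg, ZMod.stdAddChar_coe, ZMod.stdAddChar_coe]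
  push_cast
  rw [Complex.two_cos]
  congr 2 <;> ring

theorem dft_lap (hd : 1 ≤ d) (f : DTorus d n → ℝ) (ξ : Fin d → ℤ) :
    dft (lap d n f) ξ = -(eigenvalue n ξ) * dft f ξ := by
  have hd' : (d : ℂ) ≠ 0 := by
    have : d ≠ 0 := by omega
    exact_mod_cast this
  have hlap : dft (lap d n f) ξ = (2 * (d : ℂ))⁻¹ * ∑ i : Fin d,
      (dft (fun x => f (x + Pi.single i 1)) ξ + dft (fun x => f (x - Pi.single i 1)) ξ)
        - dft f ξ := by
    simp only [dft_def, lap_apply]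
    simp only [← mul_add, ← Finset.mul_sum, ← Finset.sum_add_distrib, ← add_mul]
    rw [Finset.sum_comm, mul_left_comm, ← mul_sub]
    refine congrArg _ ?_
    rw [Finset.mul_sum, ← Finset.sum_sub_distrib]
    refine Finset.sum_congr rfl fun z _ => ?_
    rw [← Finset.sum_mul]
    push_cast
    ring
  have hone (a : Fin d) : ∑ i, (Pi.single a 1 : DTorus d n) i * redFreq n ξ i = ξ a := by
    simp [Pi.single_apply, redFreq]
  have hneg (a : Fin d) : ∑ i, (-(Pi.single a 1 : DTorus d n)) i * redFreq n ξ i = -ξ a := by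
    simp [Pi.single_apply, redFreq]
  simp only [hlap, sub_eq_add_neg, dft_translate, hone, hneg, ← add_mul, stdAddChar_add_neg]
  rw [← Finset.sum_mul, eigenvalue]
  push_cast
  simp only [Finset.sum_sub_distrib, ← Finset.mul_sum, Finset.sum_const, Finset.card_univ,
    Fintype.card_fin, nsmul_eq_mul]
  field_simp
  ring

/-- At a frequency that is nonzero modulo `n`, the odometer is the weights divided by the eigenvalue
of `-Δ`. -/
theorem eigenvalue_mul_dft_odometer (hd : 1 ≤ d) (σ : DTorus d n → ℝ) {ξ : Fin d → ℤ}
    (hξ : redFreq n ξ ≠ 0) :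
    eigenvalue n ξ * dft (fun z => (odometer (initialConfig σ) z).toReal) ξ = dft σ ξ := by
  have h := dft_lap hd (fun z => (odometer (initialConfig σ) z).toReal) ξ
  rw [lap_odometer hd (sum_initialConfig σ)] at h
  have h1 : (fun x => 1 - initialConfig σ x)
      = (fun _ => ((n : ℝ) ^ d)⁻¹ * ∑ z, σ z) + (-1 : ℝ) • σ := by
    funext x
    simp only [initialConfig, Pi.add_apply, Pi.smul_apply, smul_eq_mul]
    ring
  rw [h1, dft_add, dft_smul, dft_const, if_neg hξ] at h
  push_cast at h
  linear_combination h

theorem eight_div_le_eigenvalue (hd : 1 ≤ d) {ξ : Fin d → ℤ} (hξ : redFreq n ξ ≠ 0) :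
    8 / (d * (n : ℝ) ^ 2) ≤ eigenvalue n ξ := by
  obtain ⟨i, hi⟩ := Function.ne_iff.mp hξ
  have hn : (0 : ℝ) < n := Nat.cast_pos.mpr (NeZero.pos n)
  have hd' : (0 : ℝ) < d := by exact_mod_cast hd
  -- the distance `|x|` of `ξ i / n` to the nearest integer is at least `1 / n`
  set x : ℝ := ξ i / n - round ((ξ i : ℝ) / n) with hx
  have hx2 : |x| ≤ 1 / 2 := abs_sub_round _
  have hx1 : 1 / (n : ℝ) ≤ |x| := by
    have h1 : x = ((ξ i - round ((ξ i : ℝ) / n) * n : ℤ) : ℝ) / n := by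
      rw [hx]
      push_cast
      field_simp
    have h2 : ξ i - round ((ξ i : ℝ) / n) * n ≠ 0 := by
      intro h
      apply hi
      have h3 : ξ i = round ((ξ i : ℝ) / n) * n := by linarith
      simp only [redFreq, Pi.zero_apply]
      rw [h3]
      simp
    have h3 : (1 : ℝ) ≤ |((ξ i - round ((ξ i : ℝ) / n) * n : ℤ) : ℝ)| := by
      exact_mod_cast Int.one_le_abs h2
    rw [h1, abs_div, abs_of_pos hn]
    gcongr
  have hcos : Real.cos (2 * Real.pi * ξ i / n) ≤ 1 - 8 / (n : ℝ) ^ 2 := by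
    have h1 : Real.cos (2 * Real.pi * ξ i / n) = Real.cos (2 * Real.pi * x) := by
      rw [← Real.cos_sub_int_mul_two_pi _ (round ((ξ i : ℝ) / n)), hx]
      congr 1
      ring
    have h2 : |2 * Real.pi * x| ≤ Real.pi := by
      rw [abs_mul, abs_of_pos Real.two_pi_pos]
      nlinarith [Real.pi_pos]
    have h3 := Real.cos_le_one_sub_mul_cos_sq h2
    have h4 : (1 / (n : ℝ)) ^ 2 ≤ x ^ 2 := by
      rw [← sq_abs x]
      gcongr
    rw [h1]
    refine h3.trans ?_
    have h5 : 2 / Real.pi ^ 2 * (2 * Real.pi * x) ^ 2 = 8 * x ^ 2 := by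
      field_simp
      ring
    rw [h5]
    have h6 : (8 : ℝ) / (n : ℝ) ^ 2 = 8 * (1 / (n : ℝ)) ^ 2 := by ring
    rw [h6]
    linarith
  have hsum : 8 / (n : ℝ) ^ 2 ≤ ∑ i, (1 - Real.cos (2 * Real.pi * ξ i / n)) := by
    refine le_trans ?_ (Finset.single_le_sum (f := fun i => 1 - Real.cos (2 * Real.pi * ξ i / n))
      (fun j _ => sub_nonneg.mpr (Real.cos_le_one _)) (Finset.mem_univ i))
    linarith
  calc 8 / (d * (n : ℝ) ^ 2) = (d : ℝ)⁻¹ * (8 / (n : ℝ) ^ 2) := by field_simp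
    _ ≤ eigenvalue n ξ := by
      rw [eigenvalue]
      gcongr

end DiscreteFourier

theorem tendsto_const_div_pnat (c : ℝ) :
    Tendsto (fun n : ℕ+ => c / ((n : ℕ) : ℝ)) atTop (𝓝 0) :=
  (tendsto_const_div_atTop_nhds_zero_nat c).comp tendsto_PNat_val_atTop_atTop

theorem tendsto_scaling_div_eigenvalue {d : ℕ} (hd : 1 ≤ d) {ξ : Fin d → ℤ} (hξ : ξ ≠ 0) :
    Tendsto (fun n : ℕ+ => scaling d n / eigenvalue n ξ) atTop (𝓝 ((freqNorm ξ ^ 2)⁻¹)) := by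
  have hd' : (d : ℝ) ≠ 0 := by positivity
  have hξ' := (SobolevSpace.freqNorm_pos hξ).ne'
  have h1 (i : Fin d) : Tendsto (fun n : ℕ+ => ((n : ℕ) : ℝ) ^ 2 *
      (1 - Real.cos (2 * Real.pi * ξ i / (n : ℕ)))) atTop (𝓝 (2 * (Real.pi * ξ i) ^ 2)) := by
    have h2 (n : ℕ+) : ((n : ℕ) : ℝ) ^ 2 * (1 - Real.cos (2 * Real.pi * ξ i / (n : ℕ)))
        = 2 * (Real.pi * ξ i * Real.sinc (Real.pi * ξ i / (n : ℕ))) ^ 2 := by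
      have hn : ((n : ℕ) : ℝ) ≠ 0 := by positivity
      have h3 : 2 * Real.pi * ξ i / (n : ℕ) = 2 * (Real.pi * ξ i / (n : ℕ)) := by ring
      have h4 := Real.sin_sq_add_cos_sq (Real.pi * ξ i / (n : ℕ))
      rw [h3, Real.cos_two_mul]
      by_cases h0 : Real.pi * ξ i = 0
      · simp [h0]
        norm_num
      · rw [Real.sinc_of_ne_zero (div_ne_zero h0 hn)]
        have h5 : Real.pi * ξ i * (Real.sin (Real.pi * ξ i / (n : ℕ)) / (Real.pi * ξ i / (n : ℕ)))
            = (n : ℕ) * Real.sin (Real.pi * ξ i / (n : ℕ)) := by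
          rw [div_div_eq_mul_div, mul_div_cancel₀ _ h0, mul_comm]
        rw [h5, mul_pow]
        linear_combination (-2 * ((n : ℕ) : ℝ) ^ 2) * h4
    simp only [h2]
    have h3 := (Real.continuous_sinc.tendsto 0).comp (tendsto_const_div_pnat (Real.pi * ξ i))
    rw [Real.sinc_zero] at h3
    simpa using ((h3.const_mul (Real.pi * ξ i)).pow 2).const_mul 2
  have h2 := (tendsto_finsetSum Finset.univ fun i _ => h1 i).const_mul (d : ℝ)⁻¹
  have h3 : (d : ℝ)⁻¹ * ∑ i, 2 * (Real.pi * ξ i) ^ 2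
      = 4 * Real.pi ^ 2 * (2 * (d : ℝ))⁻¹ * freqNorm ξ ^ 2 := by
    rw [freqNorm, Real.sq_sqrt (by positivity)]
    simp only [mul_pow, ← Finset.mul_sum]
    field_simp
    ring
  rw [h3] at h2
  have h4 : 4 * Real.pi ^ 2 * (2 * (d : ℝ))⁻¹ * freqNorm ξ ^ 2 ≠ 0 := by
    have := Real.pi_ne_zero
    positivity
  have h5 := (tendsto_const_nhds (x := 4 * Real.pi ^ 2 * (2 * (d : ℝ))⁻¹)).div h2 h4
  refine (h5.congr fun n => ?_).trans (le_of_eq ?_)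
  · have hn : ((n : ℕ) : ℝ) ≠ 0 := by positivity
    simp only [Pi.div_apply, scaling, eigenvalue, ← Finset.mul_sum]
    rw [mul_left_comm, div_eq_mul_inv, div_eq_mul_inv, mul_inv (((n : ℕ) : ℝ) ^ 2), ← mul_assoc]
  · congr 1
    have := Real.pi_ne_zero
    field_simp

/-! ### Fourier coefficients of the interpolated field -/

section Torus

variable {d n : ℕ}

theorem mFourierCoeff_eq_volume (f : UnitAddTorus (Fin d) → ℂ) (ξ : Fin d → ℤ) :
    UnitAddTorus.mFourierCoeff f ξ = ∫ t, UnitAddTorus.mFourier (-ξ) t * f t := by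
  have h : (volume : Measure (UnitAddTorus (Fin d))) =
      Measure.pi fun _ => AddCircle.haarAddCircle := by
    rw [volume_pi]
    congr
    funext i
    rw [AddCircle.volume_eq_smul_haarAddCircle]
    simp
  rw [h]
  rfl

theorem mFourier_add_apply (ξ : Fin d → ℤ) (x y : UnitAddTorus (Fin d)) :
    UnitAddTorus.mFourier ξ (x + y) = UnitAddTorus.mFourier ξ x * UnitAddTorus.mFourier ξ y := by
  simp only [UnitAddTorus.mFourier, ContinuousMap.coe_mk, ← Finset.prod_mul_distrib]
  refine Finset.prod_congr rfl fun i _ => ?_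
  simp [fourier_apply, smul_add, AddCircle.toCircle_add]

theorem mFourier_zero_apply (ξ : Fin d → ℤ) :
    UnitAddTorus.mFourier ξ (0 : UnitAddTorus (Fin d)) = 1 := by
  simp [UnitAddTorus.mFourier]

theorem norm_mFourier_apply (ξ : Fin d → ℤ) (x : UnitAddTorus (Fin d)) :
    ‖UnitAddTorus.mFourier ξ x‖ = 1 := by
  simp only [UnitAddTorus.mFourier, ContinuousMap.coe_mk, norm_prod, fourier_apply,
    Circle.norm_coe, Finset.prod_const_one]

theorem integrable_mFourier (ξ : Fin d → ℤ) :
    Integrable (fun x : UnitAddTorus (Fin d) => UnitAddTorus.mFourier ξ x) :=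
  (UnitAddTorus.mFourier ξ).continuous.integrable_of_hasCompactSupport
    (HasCompactSupport.of_compactSpace _)

theorem integral_mFourier {ξ : Fin d → ℤ} (hξ : ξ ≠ 0) :
    ∫ x : UnitAddTorus (Fin d), UnitAddTorus.mFourier ξ x = 0 := by
  obtain ⟨i, hi⟩ := Function.ne_iff.mp hξ
  refine integral_eq_zero_of_add_right_eq_neg
    (g := (Pi.single i ((1 / 2 / (ξ i) : ℝ) : UnitAddCircle) : UnitAddTorus (Fin d))) fun x => ?_
  have h : UnitAddTorus.mFourier ξ (Pi.single i ((1 / 2 / (ξ i) : ℝ) : UnitAddCircle) :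
      UnitAddTorus (Fin d)) = -1 := by
    have h0 := fourier_add_half_inv_index (T := 1) hi (by norm_num) 0
    simp only [fourier_eval_zero, zero_add] at h0
    simp only [UnitAddTorus.mFourier, ContinuousMap.coe_mk]
    rw [Finset.prod_eq_single i]
    · rw [Pi.single_eq_same, h0]
    · intro j _ hj
      rw [Pi.single_eq_of_ne hj, fourier_eval_zero]
    · simp
  rw [mFourier_add_apply, h, mul_neg_one]

variable [NeZero n]

theorem mFourier_toTorus (ξ : Fin d → ℤ) (z : DTorus d n) :
    UnitAddTorus.mFourier (-ξ) (toTorus z) = ZMod.stdAddChar (-∑ i, z i * redFreq n ξ i) := by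
  rw [← Finset.sum_neg_distrib, stdAddChar_sum]
  simp only [UnitAddTorus.mFourier, ContinuousMap.coe_mk]
  refine Finset.prod_congr rfl fun i _ => ?_
  have h : (-ξ) i • (ZMod.toAddCircle (z i) : UnitAddCircle)
      = ZMod.toAddCircle (-(z i * redFreq n ξ i)) := by
    rw [← map_zsmul]
    congr 1
    simp [redFreq, mul_comm]
  rw [fourier_apply, toTorus, h]
  rfl

/-- The open ball of radius `1 / (2n)`, a cell of the grid `(n⁻¹ ℤ / ℤ)^d`, has volume `n^{-d}`. -/
theorem volume_cell (a : UnitAddTorus (Fin d)) :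
    volume (Metric.ball a (1 / (2 * (n : ℝ)))) = ENNReal.ofReal (((n : ℝ) ^ d)⁻¹) := by
  have hn : (1 : ℝ) ≤ n := by exact_mod_cast NeZero.one_le
  have hr : (0 : ℝ) < 1 / (2 * (n : ℝ)) := by positivity
  have h1 (x : UnitAddCircle) : volume (Metric.ball x (1 / (2 * (n : ℝ))))
      = ENNReal.ofReal ((n : ℝ)⁻¹) := by
    rw [← measure_congr AddCircle.closedBall_ae_eq_ball, AddCircle.volume_closedBall]
    congr 1
    rw [show 2 * (1 / (2 * (n : ℝ))) = (n : ℝ)⁻¹ by field_simp]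
    exact min_eq_right (inv_le_one_of_one_le₀ hn)
  rw [volume_pi_ball _ hr]
  simp only [h1, Finset.prod_const, Finset.card_univ, Fintype.card_fin]
  rw [← ENNReal.ofReal_pow (by positivity), inv_pow]

/-- The normalized Fourier transform `n^d ∫_{B(0, 1/(2n))} exp(-2πi ξ·x) dx` of a cell. -/
noncomputable def cellFourier (n : ℕ) (ξ : Fin d → ℤ) : ℂ :=
  (n : ℂ) ^ d * ∫ x in Metric.ball (0 : UnitAddTorus (Fin d)) (1 / (2 * (n : ℝ))),
    UnitAddTorus.mFourier (-ξ) x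

theorem setIntegral_cell (ξ : Fin d → ℤ) (z : DTorus d n) :
    ∫ x in Metric.ball (toTorus z) (1 / (2 * (n : ℝ))), UnitAddTorus.mFourier (-ξ) x =
      ZMod.stdAddChar (-∑ i, z i * redFreq n ξ i) * (((n : ℂ) ^ d)⁻¹ * cellFourier n ξ) := by
  have hn : ((n : ℂ) ^ d) ≠ 0 := pow_ne_zero _ (NeZero.ne _)
  rw [cellFourier, inv_mul_cancel_left₀ hn, ← mFourier_toTorus,
    ← integral_indicator Metric.isOpen_ball.measurableSet,
    ← integral_indicator Metric.isOpen_ball.measurableSet,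
    ← integral_add_right_eq_self _ (toTorus z), ← integral_const_mul]
  refine integral_congr_ae (Eventually.of_forall fun x => ?_)
  have hmem : x + toTorus z ∈ Metric.ball (toTorus z) (1 / (2 * (n : ℝ)))
      ↔ x ∈ Metric.ball 0 (1 / (2 * (n : ℝ))) := by
    simp [Metric.mem_ball, dist_eq_norm]
  by_cases hx : x ∈ Metric.ball 0 (1 / (2 * (n : ℝ)))
  · simp only [Set.indicator_of_mem hx, Set.indicator_of_mem (hmem.mpr hx)]
    rw [mFourier_add_apply, mul_comm]
  · simp only [Set.indicator_of_notMem hx, Set.indicator_of_notMem (mt hmem.mp hx), mul_zero]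

theorem mFourierCoeff_interpolation (u : DTorus d n → ℝ) (ξ : Fin d → ℤ) :
    UnitAddTorus.mFourierCoeff (fun x => (interpolation u x : ℂ)) ξ =
      cellFourier n ξ * dft u ξ := by
  have h (x : UnitAddTorus (Fin d)) : UnitAddTorus.mFourier (-ξ) x * (interpolation u x : ℂ) =
      ∑ z, (u z : ℂ) * (Metric.ball (toTorus z) (1 / (2 * (n : ℝ)))).indicator
        (fun x => UnitAddTorus.mFourier (-ξ) x) x := by
    simp only [interpolation, Complex.ofReal_sum, Finset.mul_sum]
    refine Finset.sum_congr rfl fun z _ => ?_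
    by_cases hx : x ∈ Metric.ball (toTorus z) (1 / (2 * (n : ℝ)))
    · simp only [Set.indicator_of_mem hx]
      rw [mul_comm]
    · simp only [Set.indicator_of_notMem hx, Complex.ofReal_zero, mul_zero]
  rw [mFourierCoeff_eq_volume]
  simp only [h]
  rw [integral_finsetSum _ fun z _ => ((integrable_mFourier (-ξ)).indicator
    Metric.isOpen_ball.measurableSet).const_mul _]
  simp only [integral_const_mul, integral_indicator Metric.isOpen_ball.measurableSet,
    setIntegral_cell, dft_def, Finset.mul_sum]
  exact Finset.sum_congr rfl fun z _ => by ring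

theorem volume_real_cell (a : UnitAddTorus (Fin d)) :
    volume.real (Metric.ball a (1 / (2 * (n : ℝ)))) = ((n : ℝ) ^ d)⁻¹ := by
  rw [Measure.real, volume_cell, ENNReal.toReal_ofReal (by positivity)]

theorem norm_cellFourier_le (ξ : Fin d → ℤ) : ‖cellFourier n ξ‖ ≤ 1 := by
  have hn : ((n : ℝ) ^ d) ≠ 0 := pow_ne_zero _ (NeZero.ne _)
  have h := norm_setIntegral_le_of_norm_le_const (μ := volume)
    (s := Metric.ball (0 : UnitAddTorus (Fin d)) (1 / (2 * (n : ℝ))))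
    (f := fun x => UnitAddTorus.mFourier (-ξ) x) (C := 1) (measure_lt_top _ _)
    (fun x _ => (norm_mFourier_apply _ x).le)
  rw [volume_real_cell, one_mul] at h
  rw [cellFourier, norm_mul, norm_pow, Complex.norm_natCast]
  calc (n : ℝ) ^ d * _ ≤ (n : ℝ) ^ d * ((n : ℝ) ^ d)⁻¹ := by gcongr
    _ = 1 := mul_inv_cancel₀ hn

theorem disjoint_cell {z w : DTorus d n} (hzw : z ≠ w) :
    Disjoint (Metric.ball (toTorus z) (1 / (2 * (n : ℝ))))
      (Metric.ball (toTorus w) (1 / (2 * (n : ℝ)))) := by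
  have hn : (0 : ℝ) < n := Nat.cast_pos.mpr (NeZero.pos n)
  refine Metric.ball_disjoint_ball ?_
  obtain ⟨i, hi⟩ := Function.ne_iff.mp hzw
  have h1 : dist (toTorus z i) (toTorus w i) ≤ dist (toTorus z) (toTorus w) := dist_le_pi_dist _ _ i
  refine le_trans ?_ h1
  -- a nonzero element of `n⁻¹ ℤ / ℤ` has norm at least `1 / n`
  have h2 : dist (toTorus z i) (toTorus w i) = ‖(ZMod.toAddCircle (z i - w i) : UnitAddCircle)‖ := by
    rw [dist_eq_norm, map_sub]
    rfl
  rw [h2]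
  have hne : (ZMod.toAddCircle (z i - w i) : UnitAddCircle) ≠ 0 :=
    fun h => hi (sub_eq_zero.mp (ZMod.toAddCircle_eq_zero.mp h))
  have hord : n • (ZMod.toAddCircle (z i - w i) : UnitAddCircle) = 0 := by
    rw [← map_nsmul]
    simp
  have hfin : IsOfFinAddOrder (ZMod.toAddCircle (z i - w i) : UnitAddCircle) :=
    isOfFinAddOrder_iff_nsmul_eq_zero.mpr ⟨n, NeZero.pos n, hord⟩
  have h3 := AddCircle.le_add_order_smul_norm_of_isOfFinAddOrder hfin hne
  have h4 : addOrderOf (ZMod.toAddCircle (z i - w i) : UnitAddCircle) ≤ n :=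
    addOrderOf_le_of_nsmul_eq_zero (NeZero.pos n) hord
  rw [nsmul_eq_mul] at h3
  have h5 : (1 : ℝ) ≤ n * ‖(ZMod.toAddCircle (z i - w i) : UnitAddCircle)‖ := by
    refine h3.trans ?_
    gcongr
  have h6 : 1 / (2 * (n : ℝ)) + 1 / (2 * (n : ℝ)) = 1 / n := by field_simp; norm_num
  rw [h6, div_le_iff₀' hn]
  exact h5

theorem ae_mem_cell :
    ∀ᵐ x : UnitAddTorus (Fin d), x ∈ ⋃ z : DTorus d n, Metric.ball (toTorus z) (1 / (2 * (n : ℝ))) := by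
  have hn : ((n : ℝ) ^ d) ≠ 0 := pow_ne_zero _ (NeZero.ne _)
  have h : volume (⋃ z : DTorus d n, Metric.ball (toTorus z) (1 / (2 * (n : ℝ)))) = 1 := by
    rw [measure_iUnion (fun z w hzw => disjoint_cell hzw) fun z => Metric.isOpen_ball.measurableSet]
    simp only [volume_cell, tsum_fintype, Finset.sum_const, Finset.card_univ, Fintype.card_pi,
      ZMod.card, Finset.prod_const, Fintype.card_fin, nsmul_eq_mul]
    rw [← ENNReal.ofReal_natCast, ← ENNReal.ofReal_mul (by positivity)]
    push_cast
    rw [mul_inv_cancel₀ hn, ENNReal.ofReal_one]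
  have huniv : volume (Set.univ : Set (UnitAddTorus (Fin d))) = 1 := by
    rw [volume_pi, Measure.pi_univ]
    simp
  have : IsProbabilityMeasure (volume : Measure (UnitAddTorus (Fin d))) := ⟨huniv⟩
  exact mem_ae_iff_prob_eq_one
    (MeasurableSet.iUnion fun z => Metric.isOpen_ball.measurableSet) |>.mpr h

/-- The cells around the points of the grid tile the torus, and a character of frequency
`ξ ∈ n ℤ^d` has the same integral over all of them, so these integrals vanish. -/
theorem cellFourier_eq_zero {ξ : Fin d → ℤ} (hξ : ξ ≠ 0) (hn : redFreq n ξ = 0) :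
    cellFourier n ξ = 0 := by
  have hn' : ((n : ℂ) ^ d) ≠ 0 := pow_ne_zero _ (NeZero.ne _)
  have h1 : ∫ x in ⋃ z : DTorus d n, Metric.ball (toTorus z) (1 / (2 * (n : ℝ))),
      UnitAddTorus.mFourier (-ξ) x = 0 := by
    rw [Measure.restrict_eq_self_of_ae_mem ae_mem_cell]
    exact integral_mFourier (neg_ne_zero.mpr hξ)
  rw [integral_iUnion_fintype (fun z => Metric.isOpen_ball.measurableSet)
    (fun z w hzw => disjoint_cell hzw) fun z => (integrable_mFourier _).integrableOn] at h1
  simp only [setIntegral_cell, hn, Pi.zero_apply, mul_zero, Finset.sum_const_zero, neg_zero,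
    AddChar.map_zero_eq_one, one_mul, Finset.sum_const, Finset.card_univ, Fintype.card_pi,
    ZMod.card, Finset.prod_const, Fintype.card_fin, nsmul_eq_mul, Nat.cast_pow] at h1
  rwa [mul_inv_cancel_left₀ hn'] at h1

end Torus

theorem tendsto_cellFourier {d : ℕ} (ξ : Fin d → ℤ) :
    Tendsto (fun n : ℕ+ => cellFourier n ξ) atTop (𝓝 1) := by
  rw [Metric.tendsto_nhds]
  intro δ hδ
  have hcont := (UnitAddTorus.mFourier (-ξ)).continuous.tendsto (0 : UnitAddTorus (Fin d))
  rw [mFourier_zero_apply, Metric.tendsto_nhds_nhds] at hcont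
  obtain ⟨r, hr, hball⟩ := hcont (δ / 2) (half_pos hδ)
  filter_upwards [(tendsto_const_div_pnat (1 / 2)).eventually_lt_const hr] with n hnr
  have hn : (((n : ℕ) : ℝ) ^ d) ≠ 0 := by positivity
  have hn' : (((n : ℕ) : ℂ) ^ d) ≠ 0 := by
    exact_mod_cast hn
  have hrad : 1 / (2 * ((n : ℕ) : ℝ)) < r := by
    rwa [div_div] at hnr
  have h1 : cellFourier n ξ - 1 = ((n : ℕ) : ℂ) ^ d *
      ∫ x in Metric.ball (0 : UnitAddTorus (Fin d)) (1 / (2 * ((n : ℕ) : ℝ))),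
        (UnitAddTorus.mFourier (-ξ) x - 1) := by
    rw [integral_sub (integrable_mFourier _).integrableOn (integrable_const _), setIntegral_const,
      volume_real_cell, mul_sub, cellFourier]
    congr 1
    rw [Complex.real_smul]
    push_cast
    rw [mul_one, mul_inv_cancel₀ hn']
  have h2 := norm_setIntegral_le_of_norm_le_const (μ := volume)
    (s := Metric.ball (0 : UnitAddTorus (Fin d)) (1 / (2 * ((n : ℕ) : ℝ))))
    (f := fun x => UnitAddTorus.mFourier (-ξ) x - 1) (C := δ / 2) (measure_lt_top _ _)
    (fun x hx => by
      rw [← dist_eq_norm]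
      exact (hball (lt_trans hx hrad)).le)
  rw [volume_real_cell] at h2
  rw [dist_eq_norm, h1, norm_mul, norm_pow, Complex.norm_natCast]
  calc ((n : ℕ) : ℝ) ^ d * _ ≤ ((n : ℕ) : ℝ) ^ d * (δ / 2 * (((n : ℕ) : ℝ) ^ d)⁻¹) := by gcongr
    _ = δ / 2 := by field_simp
    _ < δ := half_lt_self hδ

/-- The Fourier multiplier sending the weights `σ` to the rescaled field `a_n Ξ_n`. If `ξ ≠ 0`
vanishes modulo `n`, the quotient is `0` by convention (its denominator vanishes), which is harmless as
`cellFourier n ξ` is then `0` as well. -/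
noncomputable def multiplier {d : ℕ} (n : ℕ) (ξ : Fin d → ℤ) : ℂ :=
  ((scaling d n / eigenvalue n ξ : ℝ) : ℂ) * cellFourier n ξ

/-- The random field depends linearly on the weights, through a Fourier multiplier. -/
theorem mFourierCoeff_scaledField {d n : ℕ} [NeZero n] (hd : 1 ≤ d) (σ : DTorus d n → ℝ)
    {ξ : Fin d → ℤ} (hξ : ξ ≠ 0) :
    UnitAddTorus.mFourierCoeff (fun x => (scaledField σ x : ℂ)) ξ = multiplier n ξ * dft σ ξ := by
  have h1 : UnitAddTorus.mFourierCoeff (fun x => (scaledField σ x : ℂ)) ξ = scaling d n *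
      (cellFourier n ξ * dft (fun z => (odometer (initialConfig σ) z).toReal) ξ) := by
    rw [← mFourierCoeff_interpolation, mFourierCoeff_eq_volume, mFourierCoeff_eq_volume,
      ← integral_const_mul]
    congr 1
    funext x
    rw [scaledField]
    push_cast
    ring
  rw [h1, multiplier]
  by_cases h0 : redFreq n ξ = 0
  · simp [cellFourier_eq_zero hξ h0]
  · have hn : (0 : ℝ) < n := Nat.cast_pos.mpr (NeZero.pos n)
    have hd' : (0 : ℝ) < d := by exact_mod_cast hd
    have hpos : 0 < eigenvalue n ξ :=
      lt_of_lt_of_le (by positivity) (eight_div_le_eigenvalue hd h0)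
    have hne : (eigenvalue n ξ : ℂ) ≠ 0 := by exact_mod_cast hpos.ne'
    rw [← eigenvalue_mul_dft_odometer hd σ h0]
    push_cast
    field_simp

theorem norm_multiplier_le {d n : ℕ} [NeZero n] (hd : 1 ≤ d) {ξ : Fin d → ℤ} (hξ : ξ ≠ 0) :
    ‖multiplier n ξ‖ ≤ Real.pi ^ 2 / 4 := by
  by_cases h0 : redFreq n ξ = 0
  · rw [multiplier, cellFourier_eq_zero hξ h0, mul_zero, norm_zero]
    positivity
  · have hn : (0 : ℝ) < n := Nat.cast_pos.mpr (NeZero.pos n)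
    have hd' : (0 : ℝ) < d := by exact_mod_cast hd
    have h8 := eight_div_le_eigenvalue hd h0
    have hpos : 0 < eigenvalue n ξ := lt_of_lt_of_le (by positivity) h8
    have hs : 0 < scaling d n := by
      have := Real.pi_pos
      rw [scaling]
      positivity
    rw [multiplier, norm_mul, Complex.norm_real, Real.norm_eq_abs, abs_of_pos (div_pos hs hpos)]
    calc scaling d n / eigenvalue n ξ * ‖cellFourier n ξ‖
        ≤ scaling d n / (8 / (d * (n : ℝ) ^ 2)) * 1 := by
          gcongr
          exact norm_cellFourier_le ξ
      _ = Real.pi ^ 2 / 4 := by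
          rw [scaling]
          field_simp
          norm_num

theorem tendsto_multiplier {d : ℕ} (hd : 1 ≤ d) {ξ : Fin d → ℤ} (hξ : ξ ≠ 0) :
    Tendsto (fun n : ℕ+ => multiplier n ξ) atTop (𝓝 (((freqNorm ξ ^ 2)⁻¹ : ℝ) : ℂ)) := by
  have h := ((Complex.continuous_ofReal.tendsto _).comp
    (tendsto_scaling_div_eigenvalue hd hξ)).mul (tendsto_cellFourier ξ)
  rwa [mul_one] at h

end Sandpile

namespace Sandpile

/-! ### Hilbert cubes in `ℓ²` -/

/-- A Hilbert cube with square summable side lengths is compact: along an ultrafilter all the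
coordinates converge, and then the norms converge by dominated convergence. -/
theorem isCompact_hilbertCube {ι : Type*} {b : ι → ℝ} (hb : Summable fun i => b i ^ 2) :
    IsCompact {f : lp (fun _ : ι => ℂ) 2 | ∀ i, ‖f i‖ ≤ b i} := by
  rw [isCompact_iff_ultrafilter_le_nhds]
  intro U hU
  rw [le_principal_iff] at hU
  have hlim (i : ι) : ∃ z ∈ Metric.closedBall (0 : ℂ) (b i),
      Tendsto (fun f : lp (fun _ : ι => ℂ) 2 => f i) U (𝓝 z) := by
    obtain ⟨z, hz, hz'⟩ := (isCompact_closedBall (0 : ℂ) (b i)).ultrafilter_le_nhds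
      (U.map fun f : lp (fun _ : ι => ℂ) 2 => f i) (by
        rw [le_principal_iff, Ultrafilter.mem_coe, Ultrafilter.mem_map]
        filter_upwards [hU] with f hf
        simpa using hf i)
    exact ⟨z, hz, hz'⟩
  choose z hz hlim using hlim
  simp only [mem_closedBall_zero_iff] at hz
  have hzmem : Memℓp z 2 := by
    refine memℓp_gen (hb.of_nonneg_of_le (fun i => by positivity) fun i => ?_)
    have h0 : (2 : ENNReal).toReal = ((2 : ℕ) : ℝ) := by norm_num
    rw [h0, Real.rpow_natCast]
    gcongr
    exact hz i
  let g : lp (fun _ : ι => ℂ) 2 := ⟨z, hzmem⟩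
  refine ⟨g, hz, ?_⟩
  have hnorm (f : lp (fun _ : ι => ℂ) 2) : ‖f - g‖ ^ 2 = ∑' i, ‖f i - z i‖ ^ 2 := by
    have h := lp.norm_rpow_eq_tsum (p := 2) (by norm_num) (f - g)
    exact_mod_cast h
  have hsq : Tendsto (fun f : lp (fun _ : ι => ℂ) 2 => ‖f - g‖ ^ 2) U (𝓝 0) := by
    simp only [hnorm]
    have h := tendsto_tsum_of_dominated_convergence (𝓕 := (U : Filter (lp (fun _ : ι => ℂ) 2)))
      (f := fun f i => ‖f i - z i‖ ^ 2) (g := fun _ => (0 : ℝ)) (bound := fun i => (2 * b i) ^ 2)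
      (by simpa only [mul_pow] using hb.mul_left (2 ^ 2)) (fun i => by
        have := (((hlim i).sub_const (z i)).norm).pow 2
        simpa using this) (by
        filter_upwards [hU] with f hf i
        rw [Real.norm_of_nonneg (by positivity)]
        gcongr
        calc ‖f i - z i‖ ≤ ‖f i‖ + ‖z i‖ := norm_sub_le _ _
          _ ≤ b i + b i := add_le_add (hf i) (hz i)
          _ = 2 * b i := by ring)
    simpa using h
  have hroot := hsq.sqrt
  simp only [Real.sqrt_sq (norm_nonneg _), Real.sqrt_zero] at hroot
  exact tendsto_iff_norm_sub_tendsto_zero.mpr hroot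

instance separableSpace_lp_two {ι : Type*} [Countable ι] :
    TopologicalSpace.SeparableSpace (lp (fun _ : ι => ℂ) 2) := by
  classical
  have hc : (Set.range fun i : ι => lp.single (E := fun _ : ι => ℂ) 2 i (1 : ℂ)).Countable :=
    Set.countable_range _
  have hs := (hc.isSeparable.span (R := ℂ)).closure
  have huniv : closure (Submodule.span ℂ
      (Set.range fun i : ι => lp.single (E := fun _ : ι => ℂ) 2 i (1 : ℂ)) :
        Set (lp (fun _ : ι => ℂ) 2)) = Set.univ := by
    refine Set.eq_univ_of_forall fun f => ?_
    refine mem_closure_of_tendsto (lp.hasSum_single (by norm_num) f)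
      (Eventually.of_forall fun S => Submodule.sum_mem _ fun i _ => ?_)
    have : lp.single (E := fun _ : ι => ℂ) 2 i (f i) =
        (f i : ℂ) • lp.single (E := fun _ : ι => ℂ) 2 i (1 : ℂ) := by
      rw [← lp.single_smul, smul_eq_mul, mul_one]
    rw [this]
    exact Submodule.smul_mem _ _ (Submodule.subset_span ⟨i, rfl⟩)
  rw [huniv] at hs
  exact TopologicalSpace.isSeparable_univ_iff.mp hs

/-! ### Topology of the Sobolev spaces -/

namespace SobolevSpace

variable {d : ℕ} {K : (Fin d → ℤ) → Set.Ioi (0 : ℝ)} {a : ℝ}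

@[ext]
theorem ext {f g : SobolevSpace K a} (h : ∀ ξ, f.coeff ξ = g.coeff ξ) : f = g :=
  Subtype.ext (funext h)

@[simp] theorem coeff_zero_freq (g : SobolevSpace K a) : g.coeff 0 = 0 := g.2.1

theorem coeff_neg_freq (g : SobolevSpace K a) (ξ : Fin d → ℤ) :
    g.coeff (-ξ) = (starRingEnd ℂ) (g.coeff ξ) := g.2.2.1 ξ

@[simp] theorem coeff_add (f g : SobolevSpace K a) (ξ : Fin d → ℤ) :
    (f + g).coeff ξ = f.coeff ξ + g.coeff ξ := rfl

@[simp] theorem coeff_sub (f g : SobolevSpace K a) (ξ : Fin d → ℤ) :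
    (f - g).coeff ξ = f.coeff ξ - g.coeff ξ := rfl

@[simp] theorem coeff_smul (c : ℝ) (g : SobolevSpace K a) (ξ : Fin d → ℤ) :
    (c • g).coeff ξ = c • g.coeff ξ := rfl

theorem toL2_apply (g : SobolevSpace K a) (ξ : Fin d → ℤ) :
    toL2 g ξ = weight K a ξ • g.coeff ξ := rfl

theorem norm_toL2 (g : SobolevSpace K a) : ‖toL2 g‖ = ‖g‖ := rfl

theorem isometry_toL2 : Isometry (toL2 : SobolevSpace K a →ₗ[ℝ] lp (fun _ : Fin d → ℤ => ℂ) 2) :=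
  AddMonoidHomClass.isometry_of_norm toL2 norm_toL2

theorem weight_nonneg (ξ : Fin d → ℤ) : 0 ≤ weight K a ξ :=
  mul_nonneg (Real.sqrt_nonneg _) (Real.rpow_nonneg (Real.sqrt_nonneg _) _)

theorem weight_sq (ξ : Fin d → ℤ) : weight K a ξ ^ 2 = K ξ * freqNorm ξ ^ (4 * a) := by
  have h0 : 0 ≤ freqNorm ξ := Real.sqrt_nonneg _
  rw [weight, mul_pow, Real.sq_sqrt (K ξ).2.le, ← Real.rpow_natCast, ← Real.rpow_mul h0]
  congr 2
  push_cast
  ring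

theorem norm_weight_smul_le (g : SobolevSpace K a) (ξ : Fin d → ℤ) :
    ‖weight K a ξ • g.coeff ξ‖ ≤ ‖g‖ := by
  rw [← toL2_apply, ← norm_toL2]
  exact lp.norm_apply_le_norm (by norm_num) _ _

/-- The Fourier coefficient `g ↦ ĝ(ξ)` as a continuous linear map. -/
noncomputable def coeffCLM (ξ : Fin d → ℤ) : SobolevSpace K a →L[ℝ] ℂ :=
  LinearMap.mkContinuous
    { toFun := fun g => g.coeff ξ
      map_add' := fun _ _ => rfl
      map_smul' := fun _ _ => rfl } (weight K a ξ)⁻¹ (by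
    intro g
    change ‖g.coeff ξ‖ ≤ _
    by_cases hξ : ξ = 0
    · rw [hξ, coeff_zero_freq, norm_zero]
      exact mul_nonneg (inv_nonneg.mpr (weight_nonneg _)) (norm_nonneg _)
    · have h := norm_weight_smul_le g ξ
      rw [norm_smul, Real.norm_of_nonneg (weight_nonneg _)] at h
      rwa [le_inv_mul_iff₀ (weight_pos hξ)])

@[simp] theorem coeffCLM_apply (ξ : Fin d → ℤ) (g : SobolevSpace K a) :
    coeffCLM ξ g = g.coeff ξ := rfl

theorem range_toL2 : Set.range (toL2 : SobolevSpace K a →ₗ[ℝ] _) =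
    {h | h 0 = 0 ∧ ∀ ξ, ξ ≠ 0 →
      (weight K a (-ξ))⁻¹ • h (-ξ) = (starRingEnd ℂ) ((weight K a ξ)⁻¹ • h ξ)} := by
  ext h
  constructor
  · rintro ⟨g, rfl⟩
    refine ⟨by simp [toL2_apply], fun ξ hξ => ?_⟩
    rw [toL2_apply, toL2_apply, inv_smul_smul₀ (weight_pos hξ).ne',
      inv_smul_smul₀ (weight_pos (neg_ne_zero.mpr hξ)).ne', coeff_neg_freq]
  · rintro ⟨h0, h1⟩
    have hw (ξ : Fin d → ℤ) : weight K a ξ • ((weight K a ξ)⁻¹ • h ξ) = h ξ := by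
      by_cases hξ : ξ = 0
      · rw [hξ, h0, smul_zero, smul_zero]
      · rw [smul_inv_smul₀ (weight_pos hξ).ne']
    have hg : (fun ξ => (weight K a ξ)⁻¹ • h ξ) ∈ sobolevSubmodule K a := by
      refine ⟨by simp [h0], fun ξ => ?_, ?_⟩
      · by_cases hξ : ξ = 0
        · simp [hξ, h0]
        · exact h1 ξ hξ
      · simp only [hw]
        exact h.2
    exact ⟨⟨_, hg⟩, Subtype.ext (funext hw)⟩

theorem isClosed_range_toL2 : IsClosed (Set.range (toL2 : SobolevSpace K a →ₗ[ℝ] _)) := by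
  have hev (ξ : Fin d → ℤ) : Continuous fun h : lp (fun _ : Fin d → ℤ => ℂ) 2 => h ξ :=
    (continuous_apply ξ).comp (lp.uniformContinuous_coe (p := 2)).continuous
  rw [range_toL2]
  refine (isClosed_eq (hev 0) continuous_const).inter (s₂ := {h | ∀ ξ, ξ ≠ 0 →
    (weight K a (-ξ))⁻¹ • h (-ξ) = (starRingEnd ℂ) ((weight K a ξ)⁻¹ • h ξ)}) ?_
  simp only [Set.ofPred_forall]
  refine isClosed_iInter fun ξ => isClosed_iInter fun _ => ?_
  have h1 (η : Fin d → ℤ) : Continuous fun h : lp (fun _ : Fin d → ℤ => ℂ) 2 =>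
      ((weight K a η)⁻¹ : ℂ) * h η := continuous_const.mul (hev η)
  simp only [Complex.real_smul]
  refine isClosed_eq ?_ ?_
  · simpa using h1 (-ξ)
  · simpa [Function.comp_def] using Complex.continuous_conj.comp (h1 ξ)

theorem isClosedEmbedding_toL2 :
    IsClosedEmbedding (toL2 : SobolevSpace K a →ₗ[ℝ] lp (fun _ : Fin d → ℤ => ℂ) 2) :=
  ⟨isometry_toL2.isEmbedding, isClosed_range_toL2⟩

instance : CompleteSpace (SobolevSpace K a) :=
  (completeSpace_iff_isComplete_range isometry_toL2.isUniformInducing).mpr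
    isClosed_range_toL2.isComplete

instance : SecondCountableTopology (SobolevSpace K a) := by
  have : SecondCountableTopology (lp (fun _ : Fin d → ℤ => ℂ) 2) :=
    UniformSpace.secondCountable_of_separable _
  exact isometry_toL2.isEmbedding.secondCountableTopology

theorem isCompact_cube {b : (Fin d → ℤ) → ℝ} (hb : Summable fun ξ => b ξ ^ 2) :
    IsCompact {g : SobolevSpace K a | ∀ ξ, weight K a ξ * ‖g.coeff ξ‖ ≤ b ξ} := by
  convert isClosedEmbedding_toL2.isCompact_preimage (isCompact_hilbertCube hb) using 1
  ext g
  simp only [Set.mem_ofPred_eq, Set.mem_preimage, toL2_apply, norm_smul,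
    Real.norm_of_nonneg (weight_nonneg _)]

/-! ### Truncation of Fourier series -/

/-- The element of `H_K^a` with Fourier coefficients `m(ξ) ĝ(ξ)`, for a finitely supported
multiplier `m`; the condition `m(-ξ) = conj m(ξ)` keeps it real. -/
noncomputable def finMul {b : ℝ} (m : (Fin d → ℤ) → ℂ) (hm : m.support.Finite)
    (hm' : ∀ ξ, m (-ξ) = (starRingEnd ℂ) (m ξ)) (g : SobolevSpace K b) : SobolevSpace K a :=
  ⟨fun ξ => m ξ * g.coeff ξ, by simp, fun ξ => by
    simp only [hm', coeff_neg_freq, map_mul], by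
    refine (memℓp_zero (hm.subset fun ξ hξ => ?_)).of_exponent_ge zero_le
    intro h0
    exact hξ (by simp [h0])⟩

/-- The weight `1/2 (1_S(ξ) ± 1_S(-ξ))`, where `s` is the sign. -/
noncomputable def symWeight (s : ℝ) (S : Finset (Fin d → ℤ)) (ξ : Fin d → ℤ) : ℝ :=
  ((S : Set (Fin d → ℤ)).indicator (fun _ => (1 : ℝ)) ξ
    + s * (S : Set (Fin d → ℤ)).indicator (fun _ => (1 : ℝ)) (-ξ)) / 2

theorem finite_support_symWeight (s : ℝ) (S : Finset (Fin d → ℤ)) :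
    (Function.support (symWeight s S)).Finite := by
  refine (S.finite_toSet.union (S.finite_toSet.preimage neg_injective.injOn)).subset
    fun ξ hξ => ?_
  by_contra h
  simp only [Set.mem_union, Set.mem_preimage, not_or] at h
  exact hξ (by simp only [symWeight, Set.indicator_of_notMem h.1, Set.indicator_of_notMem h.2]; simp)

theorem symWeight_one_neg (S : Finset (Fin d → ℤ)) (ξ : Fin d → ℤ) :
    symWeight 1 S (-ξ) = symWeight 1 S ξ := by
  rw [symWeight, symWeight, neg_neg]
  ring

theorem symWeight_neg_one_neg (S : Finset (Fin d → ℤ)) (ξ : Fin d → ℤ) :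
    symWeight (-1) S (-ξ) = -symWeight (-1) S ξ := by
  rw [symWeight, symWeight, neg_neg]
  ring

/-- Restriction of a Fourier series to the frequencies in a finite set `S`, averaged with the
restriction to `-S` in order to stay real. -/
noncomputable def trunc (S : Finset (Fin d → ℤ)) (g : SobolevSpace K a) : SobolevSpace K a :=
  finMul (fun ξ => (symWeight 1 S ξ : ℂ)) ((finite_support_symWeight 1 S).subset fun ξ hξ h => hξ
    (by simp [h])) (fun ξ => by rw [symWeight_one_neg, Complex.conj_ofReal]) g

/-- The Fourier series `i/2 (1_S - 1_{-S}) ĝ`, which is real. -/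
noncomputable def antiTrunc (S : Finset (Fin d → ℤ)) (g : SobolevSpace K a) : SobolevSpace K a :=
  finMul (fun ξ => Complex.I * (symWeight (-1) S ξ : ℂ))
    ((finite_support_symWeight (-1) S).subset fun ξ hξ h => hξ (by simp [h]))
    (fun ξ => by rw [symWeight_neg_one_neg]; simp) g

@[simp] theorem coeff_trunc (S : Finset (Fin d → ℤ)) (g : SobolevSpace K a) (ξ : Fin d → ℤ) :
    (trunc S g).coeff ξ = (symWeight 1 S ξ : ℂ) * g.coeff ξ := rfl

@[simp] theorem coeff_antiTrunc (S : Finset (Fin d → ℤ)) (g : SobolevSpace K a) (ξ : Fin d → ℤ) :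
    (antiTrunc S g).coeff ξ = Complex.I * (symWeight (-1) S ξ : ℂ) * g.coeff ξ := rfl

theorem tendsto_symWeight_lp (s : ℝ) (h : lp (fun _ : Fin d → ℤ => ℂ) 2) :
    ∃ T : Finset (Fin d → ℤ) → lp (fun _ : Fin d → ℤ => ℂ) 2,
      (∀ S ξ, T S ξ = symWeight s S ξ • h ξ) ∧
      Tendsto T atTop (𝓝 (((1 + s) / 2) • h)) := by
  classical
  have h1 := lp.hasSum_single (p := 2) (by norm_num) h
  have h2 := (Equiv.neg (Fin d → ℤ)).hasSum_iff.mpr h1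
  refine ⟨fun S => (1 / 2 : ℝ) • ∑ ξ ∈ S, lp.single 2 ξ (h ξ) +
    (s / 2 : ℝ) • ∑ ξ ∈ S, lp.single 2 (-ξ) (h (-ξ)), fun S ξ => ?_, ?_⟩
  · rw [lp.coeFn_add, Pi.add_apply, lp.coeFn_smul, lp.coeFn_smul, Pi.smul_apply, Pi.smul_apply,
      lp.coeFn_sum, lp.coeFn_sum, Finset.sum_apply, Finset.sum_apply]
    have e1 : ∑ η ∈ S, (lp.single 2 η (h η) : lp (fun _ : Fin d → ℤ => ℂ) 2) ξ
        = (S : Set (Fin d → ℤ)).indicator (fun _ => (1 : ℝ)) ξ • h ξ := by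
      simp only [lp.single_apply, Pi.single_apply, Set.indicator_apply, Finset.mem_coe]
      rw [Finset.sum_ite_eq]
      split_ifs <;> simp
    have e2 : ∑ η ∈ S, (lp.single 2 (-η) (h (-η)) : lp (fun _ : Fin d → ℤ => ℂ) 2) ξ
        = (S : Set (Fin d → ℤ)).indicator (fun _ => (1 : ℝ)) (-ξ) • h ξ := by
      simp only [lp.single_apply, Pi.single_apply, Set.indicator_apply, Finset.mem_coe,
        eq_neg_iff_add_eq_zero, add_comm ξ]
      simp only [← eq_neg_iff_add_eq_zero]
      rw [Finset.sum_ite_eq']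
      split_ifs <;> simp
    rw [e1, e2, smul_smul, smul_smul, ← add_smul, symWeight]
    congr 1
    ring
  · have h3 := (h1.const_smul (1 / 2 : ℝ)).add (h2.const_smul (s / 2 : ℝ))
    have h4 : (1 / 2 : ℝ) • h + (s / 2 : ℝ) • h = ((1 + s) / 2) • h := by
      rw [← add_smul]
      congr 1
      ring
    rw [h4] at h3
    refine Tendsto.congr (fun S => ?_) h3
    simp only [Finset.sum_add_distrib, ← Finset.smul_sum, Function.comp_apply, Equiv.neg_apply]

theorem tendsto_trunc (g : SobolevSpace K a) : Tendsto (fun S => trunc S g) atTop (𝓝 g) := by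
  obtain ⟨T, hT, hlim⟩ := tendsto_symWeight_lp 1 (toL2 g)
  rw [isometry_toL2.isEmbedding.tendsto_nhds_iff]
  have h1 : (((1 : ℝ) + 1) / 2) • toL2 g = toL2 g := by norm_num
  rw [h1] at hlim
  refine hlim.congr fun S => ?_
  ext ξ
  rw [hT, Function.comp_apply, toL2_apply, toL2_apply, coeff_trunc, smul_comm]
  simp

theorem tendsto_antiTrunc (g : SobolevSpace K a) :
    Tendsto (fun S => antiTrunc S g) atTop (𝓝 0) := by
  obtain ⟨T, hT, hlim⟩ := tendsto_symWeight_lp (-1) (toL2 g)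
  rw [isometry_toL2.isEmbedding.tendsto_nhds_iff, map_zero]
  have h1 : (((1 : ℝ) + -1) / 2) • toL2 g = 0 := by norm_num
  rw [h1] at hlim
  have h2 := hlim.const_smul Complex.I
  rw [smul_zero] at h2
  refine h2.congr fun S => ?_
  ext ξ
  rw [lp.coeFn_smul, Pi.smul_apply, hT, Function.comp_apply, toL2_apply, toL2_apply,
    coeff_antiTrunc]
  simp only [Complex.real_smul, smul_eq_mul]
  ring

theorem norm_sq_eq_sum {g : SobolevSpace K a} {T : Finset (Fin d → ℤ)}
    (hT : ∀ ξ, ξ ∉ T → g.coeff ξ = 0) :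
    ‖g‖ ^ 2 = ∑ ξ ∈ T, (K ξ : ℝ) * freqNorm ξ ^ (4 * a) * ‖g.coeff ξ‖ ^ 2 := by
  rw [norm_sq_eq]
  exact tsum_eq_sum fun ξ hξ => by simp [hT ξ hξ]

end SobolevSpace

end Sandpile

namespace Sandpile

/-! ### Characterization of the limiting law by its finite-dimensional marginals -/

open SobolevSpace

variable {d : ℕ} {K : (Fin d → ℤ) → Set.Ioi (0 : ℝ)} {a : ℝ}

/-- The functional `g ↦ Re ∑_{ξ ∈ T} ĝ(ξ) conj φ(ξ)`. -/
noncomputable def finPair (T : Finset (Fin d → ℤ)) (φ : (Fin d → ℤ) → ℂ) :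
    SobolevSpace K a →L[ℝ] ℝ :=
  ∑ ξ ∈ T, Complex.reCLM.comp
    ((ContinuousLinearMap.mul ℝ ℂ ((starRingEnd ℂ) (φ ξ))).comp (coeffCLM ξ))

theorem finPair_apply (T : Finset (Fin d → ℤ)) (φ : (Fin d → ℤ) → ℂ) (g : SobolevSpace K a) :
    finPair T φ g = ∑ ξ ∈ T, (g.coeff ξ * (starRingEnd ℂ) (φ ξ)).re := by
  rw [finPair, sum_apply]
  refine Finset.sum_congr rfl fun ξ _ => ?_
  rw [mul_comm]
  rfl

/-- The smallest finite set that contains `S` and is stable under `ξ ↦ -ξ`. -/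
def symClosure (S : Finset (Fin d → ℤ)) : Finset (Fin d → ℤ) := S ∪ S.image (fun ξ => -ξ)

theorem mem_symClosure {S : Finset (Fin d → ℤ)} {ξ : Fin d → ℤ} :
    ξ ∈ symClosure S ↔ ξ ∈ S ∨ -ξ ∈ S := by
  simp only [symClosure, Finset.mem_union, Finset.mem_image]
  refine or_congr_right ⟨?_, fun h => ⟨-ξ, h, neg_neg ξ⟩⟩
  rintro ⟨η, hη, rfl⟩
  rwa [neg_neg]

theorem neg_mem_symClosure {S : Finset (Fin d → ℤ)} {ξ : Fin d → ℤ} :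
    -ξ ∈ symClosure S ↔ ξ ∈ symClosure S := by
  rw [mem_symClosure, mem_symClosure, neg_neg, or_comm]

theorem symClosure_mono {S T : Finset (Fin d → ℤ)} (h : S ⊆ T) : symClosure S ⊆ symClosure T :=
  fun ξ hξ => by
    rw [mem_symClosure] at hξ ⊢
    exact hξ.imp (fun h' => h h') fun h' => h h'

theorem subset_symClosure (S : Finset (Fin d → ℤ)) : S ⊆ symClosure S := Finset.subset_union_left

theorem sum_symClosure_neg {M : Type*} [AddCommMonoid M] (S : Finset (Fin d → ℤ))
    (F : (Fin d → ℤ) → M) : ∑ ξ ∈ symClosure S, F (-ξ) = ∑ ξ ∈ symClosure S, F ξ :=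
  Finset.sum_equiv (Equiv.neg _) (fun ξ => by simp [neg_mem_symClosure]) fun ξ _ => by simp

theorem symWeight_eq_zero {s : ℝ} {S : Finset (Fin d → ℤ)} {ξ : Fin d → ℤ}
    (h : ξ ∉ symClosure S) : symWeight s S ξ = 0 := by
  rw [mem_symClosure, not_or] at h
  have h1 : ξ ∉ (S : Set (Fin d → ℤ)) := h.1
  have h2 : -ξ ∉ (S : Set (Fin d → ℤ)) := h.2
  simp [symWeight, Set.indicator_of_notMem h1, Set.indicator_of_notMem h2]

/-- A sum over `S` of an even (`s = 1`) or odd (`s = -1`) function can be symmetrized. -/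
theorem sum_symWeight_mul {s : ℝ} (hs : s * s = 1) {S T : Finset (Fin d → ℤ)} (hST : S ⊆ T)
    {r : (Fin d → ℤ) → ℝ} (hr : ∀ ξ, r (-ξ) = s * r ξ) :
    ∑ ξ ∈ symClosure T, symWeight s S ξ * r ξ = ∑ ξ ∈ S, r ξ := by
  set χ : (Fin d → ℤ) → ℝ := (S : Set (Fin d → ℤ)).indicator (fun _ => (1 : ℝ)) with hχ
  have h1 := sum_symClosure_neg T fun ξ => s / 2 * χ (-ξ) * r ξ
  have h2 (ξ : Fin d → ℤ) : s / 2 * χ (- -ξ) * r (-ξ) = χ ξ * r ξ / 2 := by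
    rw [neg_neg, hr]
    linear_combination (χ ξ * r ξ / 2) * hs
  simp only [h2] at h1
  have h3 (ξ : Fin d → ℤ) : symWeight s S ξ * r ξ = χ ξ * r ξ / 2 + s / 2 * χ (-ξ) * r ξ := by
    rw [symWeight]
    ring
  simp only [h3, Finset.sum_add_distrib, ← h1]
  rw [← Finset.sum_add_distrib]
  have h4 : ∑ ξ ∈ S, r ξ = ∑ ξ ∈ S, χ ξ * r ξ := Finset.sum_congr rfl fun ξ hξ => by
    rw [hχ, Set.indicator_of_mem (Finset.mem_coe.mpr hξ), one_mul]
  rw [h4]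
  refine ((Finset.sum_subset (hST.trans (subset_symClosure T)) fun ξ _ hξ => ?_).trans
    (Finset.sum_congr rfl fun ξ _ => by ring)).symm
  rw [hχ, Set.indicator_of_notMem (by simpa using hξ), zero_mul]

theorem mul_conj_neg {b : ℝ} (g : SobolevSpace K a) (f : SobolevSpace K b) (ξ : Fin d → ℤ) :
    g.coeff (-ξ) * (starRingEnd ℂ) (f.coeff (-ξ)) =
      (starRingEnd ℂ) (g.coeff ξ * (starRingEnd ℂ) (f.coeff ξ)) := by
  rw [coeff_neg_freq, coeff_neg_freq, map_mul]

theorem finPair_trunc {S T : Finset (Fin d → ℤ)} (hST : S ⊆ T) (f : SobolevSpace K (-1))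
    (g : SobolevSpace K a) :
    finPair (symClosure T) (trunc S f).coeff g =
      (∑ ξ ∈ S, g.coeff ξ * (starRingEnd ℂ) (f.coeff ξ)).re := by
  rw [Complex.re_sum, ← sum_symWeight_mul (s := 1) (by norm_num) hST
    (r := fun ξ => (g.coeff ξ * (starRingEnd ℂ) (f.coeff ξ)).re) fun ξ => by
      rw [mul_conj_neg, Complex.conj_re, one_mul], finPair_apply]
  refine Finset.sum_congr rfl fun ξ _ => ?_
  rw [coeff_trunc, map_mul, Complex.conj_ofReal, mul_left_comm, Complex.re_ofReal_mul]

theorem finPair_antiTrunc {S T : Finset (Fin d → ℤ)} (hST : S ⊆ T) (f : SobolevSpace K (-1))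
    (g : SobolevSpace K a) :
    finPair (symClosure T) (antiTrunc S f).coeff g =
      (∑ ξ ∈ S, g.coeff ξ * (starRingEnd ℂ) (f.coeff ξ)).im := by
  rw [Complex.im_sum, ← sum_symWeight_mul (s := -1) (by norm_num) hST
    (r := fun ξ => (g.coeff ξ * (starRingEnd ℂ) (f.coeff ξ)).im) fun ξ => by
      rw [mul_conj_neg, Complex.conj_im, neg_one_mul], finPair_apply]
  refine Finset.sum_congr rfl fun ξ _ => ?_
  rw [coeff_antiTrunc, map_mul, map_mul, Complex.conj_ofReal, Complex.conj_I]
  have : g.coeff ξ * (-Complex.I * (symWeight (-1) S ξ : ℂ) * (starRingEnd ℂ) (f.coeff ξ))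
      = (symWeight (-1) S ξ : ℂ) *
        (-(Complex.I * (g.coeff ξ * (starRingEnd ℂ) (f.coeff ξ)))) := by ring
  rw [this, Complex.re_ofReal_mul, Complex.neg_re, Complex.I_mul_re, neg_neg]

/-- The pairings of a random element of `H_K^a` of law `μ` with the trigonometric polynomials `φ` are
centred Gaussian with variance `‖φ‖²`, the norm being the one of `H_K^{-1}`. -/
def HasFieldMarginals (μ : Measure (SobolevSpace K a)) : Prop :=
  ∀ (φ : SobolevSpace K (-1)) (T : Finset (Fin d → ℤ)), (∀ ξ, ξ ∉ T → φ.coeff ξ = 0) →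
    charFunDual μ (finPair T φ.coeff) = (Real.exp (-‖φ‖ ^ 2 / 2) : ℂ)

theorem smul_finPair (T : Finset (Fin d → ℤ)) (φ : SobolevSpace K (-1)) (u : ℝ) :
    u • (finPair T φ.coeff : SobolevSpace K a →L[ℝ] ℝ) = finPair T (u • φ).coeff := by
  ext g
  simp only [smul_apply, finPair_apply, smul_eq_mul, Finset.mul_sum,
    coeff_smul, Complex.real_smul, map_mul, Complex.conj_ofReal]
  exact Finset.sum_congr rfl fun ξ _ => by rw [mul_left_comm, Complex.re_ofReal_mul]

namespace HasFieldMarginals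

variable {μ : Measure (SobolevSpace K a)} [IsProbabilityMeasure μ]

theorem map_finPair (hμ : HasFieldMarginals μ) {φ : SobolevSpace K (-1)} {T : Finset (Fin d → ℤ)}
    (hT : ∀ ξ, ξ ∉ T → φ.coeff ξ = 0) :
    μ.map (finPair T φ.coeff : SobolevSpace K a →L[ℝ] ℝ) = gaussianReal 0 (‖φ‖ ^ 2).toNNReal := by
  have : IsProbabilityMeasure (μ.map (finPair T φ.coeff : SobolevSpace K a →L[ℝ] ℝ)) :=
    Measure.isProbabilityMeasure_map (ContinuousLinearMap.measurable _).aemeasurable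
  refine Measure.ext_of_charFun ?_
  funext u
  rw [charFun_map_eq_charFunDual_smul, smul_finPair,
    hμ (u • φ) T fun ξ hξ => by rw [coeff_smul, hT ξ hξ, smul_zero], charFun_gaussianReal,
    norm_smul, mul_pow, Real.norm_eq_abs, sq_abs, Real.coe_toNNReal _ (sq_nonneg _),
    Complex.ofReal_exp]
  congr 1
  push_cast
  ring

theorem eLpNorm_finPair (hμ : HasFieldMarginals μ) {φ : SobolevSpace K (-1)}
    {T : Finset (Fin d → ℤ)} (hT : ∀ ξ, ξ ∉ T → φ.coeff ξ = 0) :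
    eLpNorm (fun g : SobolevSpace K a => finPair T φ.coeff g) 2 μ = ENNReal.ofReal ‖φ‖ := by
  have hmeas : Measurable (fun g : SobolevSpace K a => finPair T φ.coeff g) :=
    (finPair T φ.coeff : SobolevSpace K a →L[ℝ] ℝ).measurable
  have h1 : eLpNorm (fun x : ℝ => x) 2 (μ.map fun g : SobolevSpace K a => finPair T φ.coeff g)
      = eLpNorm (fun g : SobolevSpace K a => finPair T φ.coeff g) 2 μ :=
    eLpNorm_map_measure aestronglyMeasurable_id hmeas.aemeasurable
  have hmap := hμ.map_finPair hT
  rw [← h1]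
  change eLpNorm (fun x : ℝ => x) 2 (μ.map (finPair T φ.coeff : SobolevSpace K a →L[ℝ] ℝ)) = _
  rw [hmap]
  have hvar := variance_fun_id_gaussianReal (μ := 0) (v := (‖φ‖ ^ 2).toNNReal)
  rw [variance_of_integral_eq_zero aemeasurable_id' integral_id_gaussianReal,
    Real.coe_toNNReal _ (sq_nonneg _)] at hvar
  have hmem : MemLp (fun x : ℝ => x) 2 (gaussianReal 0 (‖φ‖ ^ 2).toNNReal) := by
    exact memLp_id_gaussianReal (μ := 0) (v := (‖φ‖ ^ 2).toNNReal) 2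
  rw [hmem.eLpNorm_eq_integral_rpow_norm (by norm_num) (by norm_num)]
  congr 1
  have h2 : (2 : ENNReal).toReal = ((2 : ℕ) : ℝ) := by norm_num
  simp only [h2, Real.rpow_natCast, Real.norm_eq_abs, sq_abs, hvar]
  exact Real.pow_rpow_inv_natCast (norm_nonneg _) two_ne_zero

theorem memLp_finPair (hμ : HasFieldMarginals μ) {φ : SobolevSpace K (-1)}
    {T : Finset (Fin d → ℤ)} (hT : ∀ ξ, ξ ∉ T → φ.coeff ξ = 0) :
    MemLp (fun g : SobolevSpace K a => finPair T φ.coeff g) 2 μ :=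
  ⟨(finPair T φ.coeff : SobolevSpace K a →L[ℝ] ℝ).measurable.aestronglyMeasurable, by
    rw [hμ.eLpNorm_finPair hT]
    exact ENNReal.ofReal_lt_top⟩

theorem trunc_coeff_eq_zero {S T : Finset (Fin d → ℤ)} (hST : S ⊆ T) (f : SobolevSpace K (-1))
    (ξ : Fin d → ℤ) (hξ : ξ ∉ symClosure T) : (trunc S f).coeff ξ = 0 := by
  rw [coeff_trunc, symWeight_eq_zero fun h => hξ (symClosure_mono hST h), Complex.ofReal_zero,
    zero_mul]

theorem antiTrunc_coeff_eq_zero {S T : Finset (Fin d → ℤ)} (hST : S ⊆ T)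
    (f : SobolevSpace K (-1)) (ξ : Fin d → ℤ) (hξ : ξ ∉ symClosure T) :
    (antiTrunc S f).coeff ξ = 0 := by
  rw [coeff_antiTrunc, symWeight_eq_zero fun h => hξ (symClosure_mono hST h), Complex.ofReal_zero,
    mul_zero, zero_mul]

end HasFieldMarginals

/-- Convergence in `L²` implies convergence of characteristic functions. -/
theorem tendsto_integral_exp_of_eLpNorm {α ι : Type*} [MeasurableSpace α] {μ : Measure α}
    [IsProbabilityMeasure μ] {l : Filter ι} {X : ι → α → ℝ} {Y : α → ℝ}
    (hX : ∀ i, Measurable (X i)) (hY : Measurable Y)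
    (h : Tendsto (fun i => eLpNorm (fun ω => X i ω - Y ω) 2 μ) l (𝓝 0)) :
    Tendsto (fun i => ∫ ω, Complex.exp (Complex.I * X i ω) ∂μ) l
      (𝓝 (∫ ω, Complex.exp (Complex.I * Y ω) ∂μ)) := by
  have hint {Z : α → ℝ} (hZ : Measurable Z) :
      Integrable (fun ω => Complex.exp (Complex.I * Z ω)) μ := by
    refine Integrable.of_bound (by fun_prop) 1 (Eventually.of_forall fun ω => ?_)
    rw [mul_comm, Complex.norm_exp_ofReal_mul_I]
  rw [tendsto_iff_edist_tendsto_0]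
  refine tendsto_of_tendsto_of_tendsto_of_le_of_le tendsto_const_nhds h (fun _ => zero_le) fun i => ?_
  calc edist (∫ ω, Complex.exp (Complex.I * X i ω) ∂μ) (∫ ω, Complex.exp (Complex.I * Y ω) ∂μ)
      = ‖∫ ω, (Complex.exp (Complex.I * X i ω) - Complex.exp (Complex.I * Y ω)) ∂μ‖ₑ := by
        rw [integral_sub (hint (hX i)) (hint hY), edist_eq_enorm_sub]
    _ ≤ ∫⁻ ω, ‖Complex.exp (Complex.I * X i ω) - Complex.exp (Complex.I * Y ω)‖ₑ ∂μ :=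
        enorm_integral_le_lintegral_enorm _
    _ ≤ ∫⁻ ω, ‖X i ω - Y ω‖ₑ ∂μ := by
        refine lintegral_mono fun ω => enorm_le_iff_norm_le.mpr ?_
        have h1 : Complex.exp (Complex.I * X i ω) - Complex.exp (Complex.I * Y ω)
            = Complex.exp (Complex.I * Y ω) *
              (Complex.exp (Complex.I * ((X i ω - Y ω : ℝ) : ℂ)) - 1) := by
          rw [mul_sub, ← Complex.exp_add, mul_one]
          push_cast
          congr 2
          ring
        rw [h1, norm_mul, mul_comm Complex.I (Y ω : ℂ), Complex.norm_exp_ofReal_mul_I, one_mul]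
        exact Real.norm_exp_I_mul_ofReal_sub_one_le
    _ = eLpNorm (fun ω => X i ω - Y ω) 1 μ := by rw [eLpNorm_one_eq_lintegral_enorm]
    _ ≤ eLpNorm (fun ω => X i ω - Y ω) 2 μ :=
        eLpNorm_le_eLpNorm_of_exponent_le (by norm_num)
          ((hX i).sub hY).aestronglyMeasurable

variable {μ : Measure (SobolevSpace K a)} [IsProbabilityMeasure μ]

/-- The pairing with `f ∈ H_K^{-1}` exists: the map from trigonometric polynomials to `L²(μ)` is
isometric for the norm of `H_K^{-1}`, so the real parts of the partial sums are Cauchy, while their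
imaginary parts tend to `0` by symmetry. -/
theorem HasFieldMarginals.exists_isPairing (hμ : HasFieldMarginals μ) (f : SobolevSpace K (-1)) :
    ∃ Y : SobolevSpace K a → ℝ, IsPairing μ f Y ∧
      ∫ g, Complex.exp (Complex.I * (Y g : ℂ)) ∂μ = (Real.exp (-‖f‖ ^ 2 / 2) : ℂ) := by
  let z (S : Finset (Fin d → ℤ)) (g : SobolevSpace K a) : ℂ :=
    ∑ ξ ∈ S, g.coeff ξ * (starRingEnd ℂ) (f.coeff ξ)
  have hre {S T : Finset (Fin d → ℤ)} (hST : S ⊆ T) : (fun g : SobolevSpace K a => (z S g).re) =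
      fun g => finPair (symClosure T) (trunc S f).coeff g :=
    funext fun g => (finPair_trunc hST f g).symm
  have him (S : Finset (Fin d → ℤ)) : (fun g : SobolevSpace K a => (z S g).im) =
      fun g => finPair (symClosure S) (antiTrunc S f).coeff g :=
    funext fun g => (finPair_antiTrunc subset_rfl f g).symm
  have hmem (S : Finset (Fin d → ℤ)) : MemLp (fun g : SobolevSpace K a => (z S g).re) 2 μ := by
    rw [hre subset_rfl]
    exact hμ.memLp_finPair (trunc_coeff_eq_zero subset_rfl f)
  have hmeas (S : Finset (Fin d → ℤ)) : Measurable fun g : SobolevSpace K a => (z S g).re := by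
    rw [hre subset_rfl]
    exact (finPair (symClosure S) (trunc S f).coeff : SobolevSpace K a →L[ℝ] ℝ).measurable
  let R (S : Finset (Fin d → ℤ)) : Lp ℝ 2 μ := (hmem S).toLp
  have hdist (S T : Finset (Fin d → ℤ)) : dist (R S) (R T) = dist (trunc S f) (trunc T f) := by
    have hS := hre (Finset.subset_union_left (s₁ := S) (s₂ := T))
    have hT := hre (Finset.subset_union_right (s₁ := S) (s₂ := T))
    have h1 : (fun g : SobolevSpace K a => (z S g).re) - (fun g => (z T g).re) =
        fun g => finPair (symClosure (S ∪ T)) (trunc S f - trunc T f).coeff g := by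
      rw [hS, hT]
      funext g
      simp only [Pi.sub_apply, finPair_apply, ← Finset.sum_sub_distrib, coeff_sub, map_sub, mul_sub,
        Complex.sub_re]
    rw [dist_eq_norm, dist_eq_norm, ← MemLp.toLp_sub, Lp.norm_toLp, h1, hμ.eLpNorm_finPair,
      ENNReal.toReal_ofReal (norm_nonneg _)]
    intro ξ hξ
    rw [coeff_sub, trunc_coeff_eq_zero Finset.subset_union_left f ξ hξ,
      trunc_coeff_eq_zero Finset.subset_union_right f ξ hξ, sub_zero]
  have hcauchy : Cauchy (map R atTop) := by
    have h := (tendsto_trunc f).cauchy_map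
    rw [cauchy_map_iff'] at h ⊢
    rw [tendsto_uniformity_iff_dist_tendsto_zero] at h ⊢
    simpa only [hdist] using h
  obtain ⟨Z, hZ⟩ := cauchy_iff_exists_le_nhds.mp hcauchy
  have hZ' : Tendsto (fun S => eLpNorm (fun g => (z S g).re - Z g) 2 μ) atTop (𝓝 0) := by
    have h := (Lp.tendsto_Lp_iff_tendsto_eLpNorm' R Z).mp hZ
    refine h.congr fun S => eLpNorm_congr_ae ?_
    filter_upwards [(hmem S).coeFn_toLp] with g hg
    simp only [Pi.sub_apply, R, hg]
  have hYm : Measurable (Z : SobolevSpace K a → ℝ) := (Lp.stronglyMeasurable Z).measurable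
  have him' : Tendsto (fun S => eLpNorm (fun g : SobolevSpace K a => (z S g).im) 2 μ) atTop
      (𝓝 0) := by
    have h (S : Finset (Fin d → ℤ)) : eLpNorm (fun g : SobolevSpace K a => (z S g).im) 2 μ =
        ENNReal.ofReal ‖antiTrunc S f‖ := by
      rw [him, hμ.eLpNorm_finPair (antiTrunc_coeff_eq_zero subset_rfl f)]
    simp only [h]
    have h2 := ENNReal.tendsto_ofReal (tendsto_antiTrunc f).norm
    rwa [norm_zero, ENNReal.ofReal_zero] at h2
  refine ⟨Z, ⟨hYm, ?_⟩, ?_⟩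
  · have hadd := hZ'.add him'
    rw [add_zero] at hadd
    refine tendsto_of_tendsto_of_tendsto_of_le_of_le tendsto_const_nhds hadd (fun _ => zero_le)
      fun S => ?_
    have himm : Measurable fun g : SobolevSpace K a => (z S g).im := by
      rw [him]
      exact (finPair (symClosure S) (antiTrunc S f).coeff : SobolevSpace K a →L[ℝ] ℝ).measurable
    have h1 : (fun g : SobolevSpace K a => z S g - (Z g : ℂ)) =
        (fun g => (((z S g).re - Z g : ℝ) : ℂ)) + fun g => ((z S g).im : ℂ) * Complex.I := by
      funext g
      simp only [Pi.add_apply]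
      nth_rw 1 [← Complex.re_add_im (z S g)]
      push_cast
      ring
    change eLpNorm (fun g : SobolevSpace K a => z S g - (Z g : ℂ)) 2 μ ≤ _
    rw [h1]
    have hS := hmeas S
    refine (eLpNorm_add_le (Complex.measurable_ofReal.comp (hS.sub hYm)).aestronglyMeasurable
      ((Complex.measurable_ofReal.comp himm).mul_const _).aestronglyMeasurable
      (by norm_num)).trans (le_of_eq ?_)
    congr 1
    · exact eLpNorm_congr_norm_ae (Eventually.of_forall fun g => Complex.norm_real _)
    · refine eLpNorm_congr_norm_ae (Eventually.of_forall fun g => ?_)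
      rw [norm_mul, Complex.norm_I, mul_one]
      exact Complex.norm_real _
  · refine tendsto_nhds_unique (tendsto_integral_exp_of_eLpNorm hmeas hYm hZ') ?_
    have h1 (S : Finset (Fin d → ℤ)) : ∫ g, Complex.exp (Complex.I * ((z S g).re : ℂ)) ∂μ =
        (Real.exp (-‖trunc S f‖ ^ 2 / 2) : ℂ) := by
      have h2 := hμ (trunc S f) (symClosure S) (trunc_coeff_eq_zero subset_rfl f)
      rw [charFunDual_apply] at h2
      rw [← h2]
      refine integral_congr_ae (Eventually.of_forall fun g => ?_)
      simp only [finPair_trunc subset_rfl f g]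
      rw [mul_comm]
    simp only [h1]
    have h3 : Continuous fun x : ℝ => ((Real.exp (-x ^ 2 / 2) : ℝ) : ℂ) := by fun_prop
    exact (h3.tendsto ‖f‖).comp (tendsto_trunc f).norm

/-- The partial sums of the pairing with a trigonometric polynomial are eventually constant. -/
theorem IsLimitLaw.hasFieldMarginals {μ : Measure (SobolevSpace K a)} (hμ : IsLimitLaw μ) :
    HasFieldMarginals μ := by
  intro φ T hT
  obtain ⟨Y, ⟨hYm, hY⟩, hchar⟩ := hμ.charFunctional φ
  have hsum (S : Finset (Fin d → ℤ)) (hS : T ⊆ S) (g : SobolevSpace K a) :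
      ∑ ξ ∈ S, g.coeff ξ * (starRingEnd ℂ) (φ.coeff ξ) =
        ∑ ξ ∈ T, g.coeff ξ * (starRingEnd ℂ) (φ.coeff ξ) :=
    (Finset.sum_subset hS fun ξ _ hξ => by rw [hT ξ hξ, map_zero, mul_zero]).symm
  have h0 : eLpNorm (fun g : SobolevSpace K a =>
      (∑ ξ ∈ T, g.coeff ξ * (starRingEnd ℂ) (φ.coeff ξ)) - (Y g : ℂ)) 2 μ = 0 := by
    refine tendsto_nhds_unique (tendsto_const_nhds.congr' ?_) hY
    filter_upwards [eventually_ge_atTop T] with S hS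
    simp only [hsum S hS]
  have hmeas : AEStronglyMeasurable (fun g : SobolevSpace K a =>
      (∑ ξ ∈ T, g.coeff ξ * (starRingEnd ℂ) (φ.coeff ξ)) - (Y g : ℂ)) μ := by
    have h1 (ξ : Fin d → ℤ) : Measurable fun g : SobolevSpace K a => g.coeff ξ :=
      (coeffCLM ξ : SobolevSpace K a →L[ℝ] ℂ).measurable
    have h2 : Measurable (fun g : SobolevSpace K a =>
        (∑ ξ ∈ T, g.coeff ξ * (starRingEnd ℂ) (φ.coeff ξ)) - (Y g : ℂ)) := by
      refine Measurable.sub (Finset.measurable_fun_sum _ fun ξ _ => (h1 ξ).mul_const _) ?_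
      exact Complex.measurable_ofReal.comp hYm
    exact h2.aestronglyMeasurable
  rw [eLpNorm_eq_zero_iff hmeas (by norm_num)] at h0
  rw [← hchar, charFunDual_apply]
  refine integral_congr_ae ?_
  filter_upwards [h0] with g hg
  have h1 : finPair T φ.coeff g = Y g := by
    rw [finPair_apply, ← Complex.re_sum, sub_eq_zero.mp hg, Complex.ofReal_re]
  rw [h1, mul_comm]

/-- The real trigonometric polynomial `z e^{2πi ξ·x} + conj z e^{-2πi ξ·x}` as an element of `H_K^a`
(it is replaced by `0` for `ξ = 0`). -/
noncomputable def realMode (ξ : Fin d → ℤ) (z : ℂ) : SobolevSpace K a :=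
  ⟨fun η => if η = 0 then 0 else (if η = ξ then z else 0) +
    (if -η = ξ then (starRingEnd ℂ) z else 0), by simp, fun η => by
      simp only [neg_eq_zero, neg_neg]
      split_ifs <;> simp [add_comm], by
    refine (memℓp_zero ((Set.finite_singleton ξ).union (Set.finite_singleton (-ξ)) |>.subset
      fun η hη => ?_)).of_exponent_ge zero_le
    by_contra h
    simp only [Set.mem_union, Set.mem_singleton_iff, not_or] at h
    have h2 : -η ≠ ξ := fun h' => h.2 (by rw [← h', neg_neg])
    exact hη (by simp [h.1, h2])⟩

theorem coeff_realMode (ξ η : Fin d → ℤ) (z : ℂ) : (realMode ξ z : SobolevSpace K a).coeff η =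
    if η = 0 then 0 else (if η = ξ then z else 0) + (if -η = ξ then (starRingEnd ℂ) z else 0) := rfl

theorem realMode_eq (ξ : Fin d → ℤ) (z : ℂ) : (realMode ξ z : SobolevSpace K a) =
    z.re • realMode ξ 1 + z.im • realMode ξ Complex.I := by
  ext η
  simp only [coeff_add, coeff_smul, coeff_realMode]
  by_cases h0 : η = 0
  · simp [h0]
  · simp only [h0, if_false]
    split_ifs <;> apply Complex.ext <;> simp

theorem realMode_neg_one (ξ : Fin d → ℤ) :
    (realMode (-ξ) 1 : SobolevSpace K a) = realMode ξ 1 := by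
  ext η
  simp only [coeff_realMode, neg_inj, map_one]
  by_cases h0 : η = 0
  · simp [h0]
  · simp only [h0, if_false, neg_eq_iff_eq_neg]
    rw [add_comm]

theorem realMode_neg_I (ξ : Fin d → ℤ) :
    (realMode (-ξ) Complex.I : SobolevSpace K a) = (-1 : ℝ) • realMode ξ Complex.I := by
  ext η
  simp only [coeff_smul, coeff_realMode, neg_inj, Complex.conj_I]
  by_cases h0 : η = 0
  · simp [h0]
  · simp only [h0, if_false, neg_eq_iff_eq_neg]
    split_ifs <;> simp

/-- Every continuous functional, restricted to truncated Fourier series, is the pairing with a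
trigonometric polynomial. -/
theorem exists_finPair_eq (L : SobolevSpace K a →L[ℝ] ℝ) (S : Finset (Fin d → ℤ)) :
    ∃ φ : SobolevSpace K (-1), (∀ ξ, ξ ∉ symClosure S → φ.coeff ξ = 0) ∧
      ∀ g, L (trunc S g) = finPair (symClosure S) φ.coeff g := by
  let φ₀ (ξ : Fin d → ℤ) : ℂ := (L (realMode ξ 1) : ℂ) + L (realMode ξ Complex.I) * Complex.I
  let φ (ξ : Fin d → ℤ) : ℂ := ((symWeight 1 S ξ / 2 : ℝ) : ℂ) * φ₀ ξ
  have hz (ξ : Fin d → ℤ) (hξ : ξ ∉ symClosure S) : φ ξ = 0 := by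
    simp [φ, symWeight_eq_zero hξ]
  have hmode0 (z : ℂ) : (realMode 0 z : SobolevSpace K a) = 0 := by
    ext η
    rw [coeff_realMode]
    by_cases h0 : η = 0
    · simp [h0]
    · simp only [h0, if_false, neg_eq_zero, add_zero]
      rfl
  have hmem : φ ∈ sobolevSubmodule K (-1) := by
    refine ⟨by simp [φ, φ₀, hmode0], fun ξ => ?_, ?_⟩
    · simp only [φ, φ₀, symWeight_one_neg, realMode_neg_one, realMode_neg_I, map_mul, map_add,
        map_smul, Complex.conj_ofReal, Complex.conj_I, smul_eq_mul]
      push_cast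
      ring
    · refine (memℓp_zero ((symClosure S).finite_toSet.subset fun ξ hξ => ?_)).of_exponent_ge zero_le
      by_contra h
      exact hξ (by simp [hz ξ h])
  refine ⟨⟨φ, hmem⟩, hz, fun g => ?_⟩
  have htrunc : trunc S g =
      ∑ ξ ∈ symClosure S, (symWeight 1 S ξ / 2) • realMode ξ (g.coeff ξ) := by
    ext η
    rw [← coeffCLM_apply, ← coeffCLM_apply, map_sum]
    simp only [map_smul, coeffCLM_apply, coeff_trunc, coeff_realMode]
    by_cases h0 : η = 0
    · simp [h0]
    simp only [h0, if_false, smul_add, Finset.sum_add_distrib, smul_ite, smul_zero,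
      Finset.sum_ite_eq, neg_mem_symClosure, symWeight_one_neg, coeff_neg_freq, Complex.conj_conj]
    by_cases hη : η ∈ symClosure S
    · simp only [hη, if_true, Complex.real_smul]
      push_cast
      ring
    · simp [hη, symWeight_eq_zero hη]
  rw [htrunc, map_sum, finPair_apply]
  refine Finset.sum_congr rfl fun ξ _ => ?_
  rw [map_smul, realMode_eq, map_add, map_smul, map_smul]
  change _ = (g.coeff ξ * (starRingEnd ℂ) (φ ξ)).re
  simp only [φ, φ₀, smul_eq_mul, map_mul, map_add, Complex.conj_ofReal, Complex.conj_I]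
  rw [mul_left_comm, Complex.re_ofReal_mul]
  simp

/-- The law of the limiting field is determined by its marginals: up to truncation, which does not
matter in the limit, every continuous functional is the pairing with a trigonometric polynomial. -/
theorem HasFieldMarginals.eq {ν : Measure (SobolevSpace K a)} [IsProbabilityMeasure ν]
    (hμ : HasFieldMarginals μ) (hν : HasFieldMarginals ν) : μ = ν := by
  refine Measure.ext_of_charFunDual (funext fun L => ?_)
  have hlim (ρ : Measure (SobolevSpace K a)) [IsProbabilityMeasure ρ] :
      Tendsto (fun S => ∫ g, Complex.exp (L (trunc S g) * Complex.I) ∂ρ) atTop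
        (𝓝 (charFunDual ρ L)) := by
    rw [charFunDual_apply]
    refine tendsto_integral_filter_of_dominated_convergence (fun _ => 1)
      (Eventually.of_forall fun S => ?_) (Eventually.of_forall fun S => Eventually.of_forall
        fun g => ?_) (integrable_const _) (Eventually.of_forall fun g => ?_)
    · obtain ⟨φ, -, hφ⟩ := exists_finPair_eq L S
      simp only [hφ]
      exact Measurable.aestronglyMeasurable (by fun_prop)
    · rw [Complex.norm_exp_ofReal_mul_I]
    · have h1 : Continuous fun g => Complex.exp (L g * Complex.I) := by fun_prop
      exact (h1.tendsto g).comp (tendsto_trunc g)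
  refine tendsto_nhds_unique ((hlim μ).congr fun S => ?_) (hlim ν)
  obtain ⟨φ, hφ0, hφ⟩ := exists_finPair_eq L S
  have h1 := (hμ φ _ hφ0).trans (hν φ _ hφ0).symm
  rw [charFunDual_apply, charFunDual_apply] at h1
  simpa only [hφ] using h1

end Sandpile

namespace Sandpile

/-! ### The rescaled odometer as a random element of `H_K^a` -/

open SobolevSpace

section FieldMap

theorem summable_freqNorm_rpow {d : ℕ} {r : ℝ} (hr : r < -d) :
    Summable fun ξ : Fin d → ℤ => freqNorm ξ ^ r := by
  let b := (EuclideanSpace.basisFun (Fin d) ℝ).toBasis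
  let L : Submodule ℤ (EuclideanSpace ℝ (Fin d)) := Submodule.span ℤ (Set.range b)
  have hL : (Module.finrank ℤ L : ℝ) = d := by
    rw [ZLattice.rank ℝ L, finrank_euclideanSpace_fin]
  have h := ZLattice.summable_norm_rpow (L := L) r (by rw [hL]; exact hr)
  let f (ξ : Fin d → ℤ) : L := ⟨∑ i, ξ i • b i, Submodule.sum_mem _ fun i _ =>
    Submodule.smul_mem _ _ (Submodule.subset_span ⟨i, rfl⟩)⟩
  have hf (ξ : Fin d → ℤ) (j : Fin d) : (f ξ : EuclideanSpace ℝ (Fin d)) j = ξ j := by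
    simp only [f, b, OrthonormalBasis.coe_toBasis, EuclideanSpace.basisFun_apply, WithLp.ofLp_sum,
      Finset.sum_apply]
    rw [Finset.sum_eq_single j] <;> simp +contextual
  have hinj : Function.Injective f := fun ξ η h => funext fun j => by
    have h1 := hf ξ j
    rw [h, hf η j] at h1
    exact Int.cast_injective (α := ℝ) h1.symm
  refine (h.comp_injective hinj).congr fun ξ => ?_
  have h1 : ‖f ξ‖ = freqNorm ξ := by
    rw [Submodule.coe_norm, EuclideanSpace.norm_eq, freqNorm]
    simp only [hf, Real.norm_eq_abs, sq_abs]
  simp only [Function.comp_apply, h1]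

variable {d : ℕ} {K : (Fin d → ℤ) → Set.Ioi (0 : ℝ)} {a : ℝ}

/-- If the symbol is bounded and `a < -d/4`, all bounded sequences of Fourier coefficients belong to
`H_K^a`. -/
theorem summable_weight_sq {C : ℝ} (hK : ∀ ξ, (K ξ : ℝ) ≤ C) (ha : 4 * a < -d) :
    Summable fun ξ => weight K a ξ ^ 2 := by
  refine Summable.of_nonneg_of_le (fun ξ => sq_nonneg _) (fun ξ => ?_)
    ((summable_freqNorm_rpow ha).mul_left C)
  rw [weight_sq]
  exact mul_le_mul_of_nonneg_right (hK ξ) (Real.rpow_nonneg (Real.sqrt_nonneg _) _)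

theorem memℓp_weight_smul (hw : Summable fun ξ => weight K a ξ ^ 2) {c : (Fin d → ℤ) → ℂ} {C : ℝ}
    (hc : ∀ ξ, ‖c ξ‖ ≤ C) : Memℓp (fun ξ => weight K a ξ • c ξ) 2 := by
  refine memℓp_gen (Summable.of_nonneg_of_le (fun ξ => by positivity) (fun ξ => ?_)
    (hw.mul_left (C ^ 2)))
  have h2 : (2 : ENNReal).toReal = ((2 : ℕ) : ℝ) := by norm_num
  rw [h2, Real.rpow_natCast, norm_smul, mul_pow, Real.norm_eq_abs, sq_abs, mul_comm]
  gcongr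
  exact hc ξ

theorem eigenvalue_neg (n : ℕ) (ξ : Fin d → ℤ) : eigenvalue n (-ξ) = eigenvalue n ξ := by
  simp only [eigenvalue, Pi.neg_apply, Int.cast_neg, mul_neg, neg_div, Real.cos_neg]

theorem cellFourier_neg (n : ℕ) (ξ : Fin d → ℤ) :
    cellFourier n (-ξ) = (starRingEnd ℂ) (cellFourier n ξ) := by
  rw [cellFourier, cellFourier, map_mul, map_pow, Complex.conj_natCast, ← integral_conj]
  simp only [← UnitAddTorus.mFourier_neg]

theorem multiplier_neg (n : ℕ) (ξ : Fin d → ℤ) :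
    multiplier n (-ξ) = (starRingEnd ℂ) (multiplier n ξ) := by
  rw [multiplier, multiplier, map_mul, Complex.conj_ofReal, eigenvalue_neg, cellFourier_neg]

variable {n : ℕ} [NeZero n]

theorem norm_dft_le (f : DTorus d n → ℝ) (ξ : Fin d → ℤ) : ‖dft f ξ‖ ≤ ∑ z, |f z| := by
  rw [dft_def, norm_mul]
  have hn : (1 : ℝ) ≤ n := by exact_mod_cast NeZero.one_le
  have h1 : ‖((n : ℂ) ^ d)⁻¹‖ ≤ 1 := by
    rw [norm_inv, norm_pow, Complex.norm_natCast]
    exact inv_le_one_of_one_le₀ (one_le_pow₀ hn)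
  refine (mul_le_of_le_one_left (norm_nonneg _) h1).trans ((norm_sum_le _ _).trans ?_)
  refine Finset.sum_le_sum fun z _ => ?_
  rw [norm_mul, AddChar.norm_apply, mul_one, Complex.norm_real, Real.norm_eq_abs]

/-- The element of `H_K^a` represented by `a_n Ξ_n`, as a linear function of the weights `σ`. -/
noncomputable def fieldMap (hd : 1 ≤ d) (hw : Summable fun ξ => weight K a ξ ^ 2) :
    (DTorus d n → ℝ) →ₗ[ℝ] SobolevSpace K a where
  toFun f := ⟨fun ξ => if ξ = 0 then 0 else multiplier n ξ * dft f ξ, by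
    refine ⟨if_pos rfl, fun ξ => ?_, memℓp_weight_smul hw
      (C := Real.pi ^ 2 / 4 * ∑ z, |f z|) fun ξ => ?_⟩
    · beta_reduce
      by_cases hξ : ξ = 0
      · simp [hξ]
      · rw [if_neg hξ, if_neg (neg_ne_zero.mpr hξ), multiplier_neg, dft_neg_freq, map_mul]
    · split_ifs with hξ
      · rw [norm_zero]
        positivity
      · rw [norm_mul]
        exact mul_le_mul (norm_multiplier_le hd hξ) (norm_dft_le f ξ) (norm_nonneg _)
          (by positivity)⟩
  map_add' f g := by
    refine SobolevSpace.ext fun ξ => ?_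
    change (if ξ = 0 then 0 else multiplier n ξ * dft (f + g) ξ) =
      (if ξ = 0 then 0 else multiplier n ξ * dft f ξ) +
        if ξ = 0 then 0 else multiplier n ξ * dft g ξ
    split_ifs
    · rw [add_zero]
    · rw [dft_add, mul_add]
  map_smul' c f := by
    refine SobolevSpace.ext fun ξ => ?_
    change (if ξ = 0 then 0 else multiplier n ξ * dft (c • f) ξ) =
      c • if ξ = 0 then 0 else multiplier n ξ * dft f ξ
    split_ifs
    · rw [smul_zero]
    · rw [dft_smul, mul_left_comm, Complex.real_smul]

theorem coeff_fieldMap (hd : 1 ≤ d) (hw : Summable fun ξ => weight K a ξ ^ 2)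
    (f : DTorus d n → ℝ) {ξ : Fin d → ℤ} (hξ : ξ ≠ 0) :
    (fieldMap hd hw f).coeff ξ = multiplier n ξ * dft f ξ := if_neg hξ

theorem represents_fieldMap (hd : 1 ≤ d) (hw : Summable fun ξ => weight K a ξ ^ 2)
    (σ : DTorus d n → ℝ) : (fieldMap hd hw σ).Represents (scaledField σ) := fun ξ hξ => by
  rw [coeff_fieldMap hd hw σ hξ, mFourierCoeff_scaledField hd σ hξ]

theorem continuous_fieldMap (hd : 1 ≤ d) (hw : Summable fun ξ => weight K a ξ ^ 2) :
    Continuous (fieldMap hd hw : (DTorus d n → ℝ) →ₗ[ℝ] SobolevSpace K a) :=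
  LinearMap.continuous_of_finiteDimensional _

end FieldMap

/-! ### Covariance of the Fourier coefficients -/

section Covariance

variable {d n : ℕ} [NeZero n]

theorem dft_mul_conj_dft (f : DTorus d n → ℝ) (ξ η : Fin d → ℤ) :
    dft f ξ * (starRingEnd ℂ) (dft f η) = ((n : ℂ) ^ d)⁻¹ * ((n : ℂ) ^ d)⁻¹ *
      ∑ x, ∑ y, ((f x * f y : ℝ) : ℂ) * (ZMod.stdAddChar (-∑ i, x i * redFreq n ξ i) *
        ZMod.stdAddChar (∑ i, y i * redFreq n η i)) := by
  rw [dft_def, dft_def, map_mul, map_inv₀, map_pow, Complex.conj_natCast, map_sum,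
    mul_mul_mul_comm, Finset.sum_mul_sum]
  refine congrArg _ (Finset.sum_congr rfl fun x _ => Finset.sum_congr rfl fun y _ => ?_)
  rw [map_mul, Complex.conj_ofReal, conj_stdAddChar, neg_neg, Complex.ofReal_mul]
  ring

/-- The double character sum of a stationary kernel: distinct frequencies are orthogonal. -/
theorem sum_sum_kernel (k : DTorus d n → ℝ) (ξ η : Fin d → ℤ) :
    ((n : ℂ) ^ d)⁻¹ * ((n : ℂ) ^ d)⁻¹ *
      ∑ x, ∑ y, (k (x - y) : ℂ) * (ZMod.stdAddChar (-∑ i, x i * redFreq n ξ i) *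
        ZMod.stdAddChar (∑ i, y i * redFreq n η i)) =
      if redFreq n ξ = redFreq n η then dft k ξ else 0 := by
  have hn : ((n : ℂ) ^ d) ≠ 0 := pow_ne_zero _ (NeZero.ne _)
  have h1 (y : DTorus d n) : ∑ x, (k (x - y) : ℂ) *
      (ZMod.stdAddChar (-∑ i, x i * redFreq n ξ i) * ZMod.stdAddChar (∑ i, y i * redFreq n η i)) =
      ZMod.stdAddChar (∑ i, y i * (redFreq n η - redFreq n ξ) i) * ((n : ℂ) ^ d * dft k ξ) := by
    rw [← Equiv.sum_comp (Equiv.addRight y), dft_def, mul_inv_cancel_left₀ hn, Finset.mul_sum]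
    refine Finset.sum_congr rfl fun x _ => ?_
    have h2 : ∑ i, y i * (redFreq n η - redFreq n ξ) i =
        ∑ i, y i * redFreq n η i + -∑ i, y i * redFreq n ξ i := by
      rw [← sub_eq_add_neg, ← Finset.sum_sub_distrib]
      simp only [Pi.sub_apply, mul_sub]
    simp only [h2, Equiv.coe_addRight, add_sub_cancel_right, Pi.add_apply, add_mul,
      Finset.sum_add_distrib, neg_add, AddChar.map_add_eq_mul]
    ring
  rw [Finset.sum_comm]
  simp only [h1]
  rw [← Finset.sum_mul, sum_stdAddChar]
  by_cases h : redFreq n ξ = redFreq n η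
  · rw [if_pos h, if_pos (by rw [h, sub_self])]
    field_simp
  · rw [if_neg h, if_neg fun h' => h (sub_eq_zero.mp h').symm]
    ring

variable {Ω : Type*} [MeasurableSpace Ω] {P : Measure Ω} {σ : Ω → DTorus d n → ℝ}
  {k : DTorus d n → ℝ}

theorem integrable_dft_mul_conj_dft (hint : ∀ x y, Integrable (fun ω => σ ω x * σ ω y) P)
    (ξ η : Fin d → ℤ) :
    Integrable (fun ω => dft (σ ω) ξ * (starRingEnd ℂ) (dft (σ ω) η)) P := by
  simp only [dft_mul_conj_dft]
  exact (integrable_finsetSum _ fun x _ => integrable_finsetSum _ fun y _ =>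
    (hint x y).ofReal.mul_const _).const_mul _

theorem integral_dft_mul_conj_dft (hint : ∀ x y, Integrable (fun ω => σ ω x * σ ω y) P)
    (hcov : ∀ x y, ∫ ω, σ ω x * σ ω y ∂P = k (x - y)) (ξ η : Fin d → ℤ) :
    ∫ ω, dft (σ ω) ξ * (starRingEnd ℂ) (dft (σ ω) η) ∂P =
      if redFreq n ξ = redFreq n η then dft k ξ else 0 := by
  simp only [dft_mul_conj_dft, integral_const_mul]
  rw [← sum_sum_kernel, integral_finsetSum _ fun x _ => integrable_finsetSum _ fun y _ =>
    (hint x y).ofReal.mul_const _]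
  refine congrArg _ (Finset.sum_congr rfl fun x _ => ?_)
  rw [integral_finsetSum _ fun y _ => (hint x y).ofReal.mul_const _]
  refine Finset.sum_congr rfl fun y _ => ?_
  rw [integral_mul_const, integral_complex_ofReal, hcov]

variable {K : (Fin d → ℤ) → Set.Ioi (0 : ℝ)} {a : ℝ}

theorem coeff_fieldMap_mul_conj (hd : 1 ≤ d) (hw : Summable fun ξ => weight K a ξ ^ 2)
    (f : DTorus d n → ℝ) {ξ η : Fin d → ℤ} (hξ : ξ ≠ 0) (hη : η ≠ 0) :
    (fieldMap hd hw f).coeff ξ * (starRingEnd ℂ) ((fieldMap hd hw f).coeff η) =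
      multiplier n ξ * (starRingEnd ℂ) (multiplier n η) *
        (dft f ξ * (starRingEnd ℂ) (dft f η)) := by
  rw [coeff_fieldMap hd hw f hξ, coeff_fieldMap hd hw f hη, map_mul, mul_mul_mul_comm]

theorem integrable_coeff_fieldMap (hd : 1 ≤ d) (hw : Summable fun ξ => weight K a ξ ^ 2)
    (hint : ∀ x y, Integrable (fun ω => σ ω x * σ ω y) P) (ξ η : Fin d → ℤ) :
    Integrable (fun ω => (fieldMap hd hw (σ ω)).coeff ξ *
      (starRingEnd ℂ) ((fieldMap hd hw (σ ω)).coeff η)) P := by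
  by_cases hξ : ξ = 0
  · simp [hξ]
  by_cases hη : η = 0
  · simp [hη]
  simp only [coeff_fieldMap_mul_conj hd hw _ hξ hη]
  exact (integrable_dft_mul_conj_dft hint ξ η).const_mul _

theorem integral_coeff_fieldMap (hd : 1 ≤ d) (hw : Summable fun ξ => weight K a ξ ^ 2)
    (hint : ∀ x y, Integrable (fun ω => σ ω x * σ ω y) P)
    (hcov : ∀ x y, ∫ ω, σ ω x * σ ω y ∂P = k (x - y)) {ξ η : Fin d → ℤ} (hξ : ξ ≠ 0)
    (hη : η ≠ 0) :
    ∫ ω, (fieldMap hd hw (σ ω)).coeff ξ *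
      (starRingEnd ℂ) ((fieldMap hd hw (σ ω)).coeff η) ∂P =
      multiplier n ξ * (starRingEnd ℂ) (multiplier n η) *
        if redFreq n ξ = redFreq n η then dft k ξ else 0 := by
  simp only [coeff_fieldMap_mul_conj hd hw _ hξ hη]
  rw [integral_const_mul, integral_dft_mul_conj_dft hint hcov]

/-- Second moments of the Fourier coefficients are bounded uniformly in the frequency. -/
theorem lintegral_enorm_coeff_fieldMap_le (hd : 1 ≤ d) (hw : Summable fun ξ => weight K a ξ ^ 2)
    (hint : ∀ x y, Integrable (fun ω => σ ω x * σ ω y) P)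
    (hcov : ∀ x y, ∫ ω, σ ω x * σ ω y ∂P = k (x - y)) {C : ℝ} (hC : ∀ ξ, ‖dft k ξ‖ ≤ C)
    (ξ : Fin d → ℤ) :
    ∫⁻ ω, ENNReal.ofReal (‖(fieldMap hd hw (σ ω)).coeff ξ‖ ^ 2) ∂P ≤
      ENNReal.ofReal ((Real.pi ^ 2 / 4) ^ 2 * C) := by
  have hC0 : 0 ≤ C := (norm_nonneg _).trans (hC 0)
  by_cases hξ : ξ = 0
  · simp [hξ]
  have hsq (z : ℂ) : ((‖z‖ ^ 2 : ℝ) : ℂ) = z * (starRingEnd ℂ) z := by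
    rw [Complex.mul_conj, Complex.normSq_eq_norm_sq]
  have h1 : ((∫ ω, ‖(fieldMap hd hw (σ ω)).coeff ξ‖ ^ 2 ∂P : ℝ) : ℂ) =
      multiplier n ξ * (starRingEnd ℂ) (multiplier n ξ) * dft k ξ := by
    rw [← integral_complex_ofReal]
    simp only [hsq]
    rw [integral_coeff_fieldMap hd hw hint hcov hξ hξ, if_pos rfl]
  have h2 : Integrable (fun ω => ‖(fieldMap hd hw (σ ω)).coeff ξ‖ ^ 2) P := by
    have h := (integrable_coeff_fieldMap hd hw hint ξ ξ).norm
    simpa only [norm_mul, RCLike.norm_conj, ← sq] using h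
  rw [← ofReal_integral_eq_lintegral_ofReal h2 (Eventually.of_forall fun ω => sq_nonneg _)]
  refine ENNReal.ofReal_le_ofReal ((Real.le_norm_self _).trans ?_)
  rw [← Complex.norm_real, h1, norm_mul, norm_mul, RCLike.norm_conj, ← sq]
  have := norm_multiplier_le (n := n) hd hξ
  have := hC ξ
  gcongr

end Covariance

end Sandpile

namespace Sandpile

/-! ### Weak limits of Gaussian laws -/

open SobolevSpace

/-- A weak limit of centred Gaussian measures is Gaussian. Here `V i L` is the variance of `L` under
the `i`-th measure. The limit `c` of `exp(-V i L / 2)` cannot vanish, for otherwise the characteristic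
function `t ↦ c ^ (t²)` of `L` under the limit would be discontinuous at `0`. -/
theorem isGaussian_of_tendsto_charFunDual {E ι : Type*} [NormedAddCommGroup E] [NormedSpace ℝ E]
    [MeasurableSpace E] [BorelSpace E] {μ : Measure E} [IsProbabilityMeasure μ] {l : Filter ι}
    [l.NeBot] {V : ι → (E →L[ℝ] ℝ) → ℝ} (hV : ∀ i L (t : ℝ), V i (t • L) = t ^ 2 * V i L)
    (h : ∀ L, Tendsto (fun i => (Real.exp (-V i L / 2) : ℂ)) l (𝓝 (charFunDual μ L))) :
    IsGaussian μ := by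
  refine isGaussian_of_map_eq_gaussianReal fun L => ?_
  have : IsProbabilityMeasure (μ.map L) :=
    Measure.isProbabilityMeasure_map L.measurable.aemeasurable
  let c : ℝ := (charFunDual μ L).re
  have hc : Tendsto (fun i => Real.exp (-V i L / 2)) l (𝓝 c) := by
    exact ((Complex.continuous_re.tendsto _).comp (h L)).congr fun i => Complex.ofReal_re _
  have hc0 : 0 ≤ c := ge_of_tendsto' hc fun i => (Real.exp_pos _).le
  have hc1 : c ≤ 1 := by
    have h1 := norm_charFun_le_one (μ := μ.map L) 1
    rw [charFun_map_eq_charFunDual_smul, one_smul] at h1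
    exact (Complex.re_le_norm _).trans h1
  have hchar (t : ℝ) : charFun (μ.map L) t = ((c ^ (t ^ 2) : ℝ) : ℂ) := by
    rw [charFun_map_eq_charFunDual_smul]
    refine tendsto_nhds_unique (h (t • L)) ?_
    have h1 := hc.rpow_const (p := t ^ 2) (Or.inr (sq_nonneg t))
    refine ((Complex.continuous_ofReal.tendsto _).comp h1).congr fun i => ?_
    rw [Function.comp_apply, ← Real.exp_mul, hV]
    congr 2
    ring
  have hcpos : 0 < c := by
    refine hc0.lt_of_ne fun h0 => ?_
    have h1 : Tendsto (fun t => charFun (μ.map L) t) (𝓝[≠] 0) (𝓝 1) := by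
      have h2 := (continuous_charFun (μ := μ.map L)).tendsto 0
      simp only [charFun_zero, probReal_univ, Complex.ofReal_one] at h2
      exact h2.mono_left nhdsWithin_le_nhds
    have h2 : Tendsto (fun t => charFun (μ.map L) t) (𝓝[≠] 0) (𝓝 0) := by
      refine tendsto_const_nhds.congr' ?_
      filter_upwards [self_mem_nhdsWithin] with t ht
      rw [hchar, ← h0, Real.zero_rpow (pow_ne_zero 2 ht), Complex.ofReal_zero]
    exact one_ne_zero (tendsto_nhds_unique h1 h2)
  have hlog : Real.log c ≤ 0 := Real.log_nonpos hc0 hc1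
  refine ⟨0, (-2 * Real.log c).toNNReal, Measure.ext_of_charFun (funext fun t => ?_)⟩
  rw [hchar, charFun_gaussianReal, Real.coe_toNNReal _ (by linarith), Real.rpow_def_of_pos hcpos,
    Complex.ofReal_exp]
  congr 1
  push_cast
  ring

/-! ### Tightness -/

section Tight

variable {d : ℕ} {K : (Fin d → ℤ) → Set.Ioi (0 : ℝ)} {a : ℝ}

/-- Random Fourier series whose coefficients have uniformly bounded second moments are tight in `H_K^a`
for `a < -d/2`: the sum `∑ ‖ξ‖^{2a} |ĝ(ξ)|²` is bounded in mean, and its sublevel sets lie in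
Hilbert cubes that are compact in `H_K^a`. -/
theorem isTightMeasureSet_of_lintegral_le {ι : Type*} {Ω : ι → Type*} [∀ i, MeasurableSpace (Ω i)]
    {P : ∀ i, Measure (Ω i)} {X : ∀ i, Ω i → SobolevSpace K a}
    (hX : ∀ i, AEMeasurable (X i) (P i)) {C D : ℝ} (hK : ∀ ξ, (K ξ : ℝ) ≤ C) (ha : 2 * a < -d)
    (hD : ∀ i ξ, ∫⁻ ω, ENNReal.ofReal (‖(X i ω).coeff ξ‖ ^ 2) ∂(P i) ≤ ENNReal.ofReal D) :
    IsTightMeasureSet (Set.range fun i => (P i).map (X i)) := by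
  have hr (ξ : Fin d → ℤ) : 0 ≤ freqNorm ξ ^ (2 * a) := Real.rpow_nonneg (Real.sqrt_nonneg _) _
  have hC : 0 ≤ C := (K 0).2.le.trans (hK 0)
  let N (g : SobolevSpace K a) : ENNReal :=
    ∑' ξ, ENNReal.ofReal (freqNorm ξ ^ (2 * a)) * ENNReal.ofReal (‖g.coeff ξ‖ ^ 2)
  have hmeas (ξ : Fin d → ℤ) :
      Measurable fun g : SobolevSpace K a => ENNReal.ofReal (‖g.coeff ξ‖ ^ 2) :=
    ((coeffCLM ξ).measurable.norm.pow_const 2).ennreal_ofReal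
  have hNm : Measurable N := Measurable.tsum fun ξ => (hmeas ξ).const_mul _
  let M : ENNReal := ∑' ξ : Fin d → ℤ, ENNReal.ofReal (freqNorm ξ ^ (2 * a)) * ENNReal.ofReal D
  have hM : M ≠ ⊤ := by
    simp only [M, ENNReal.tsum_mul_right]
    exact ENNReal.mul_ne_top (summable_freqNorm_rpow ha).tsum_ofReal_ne_top ENNReal.ofReal_ne_top
  have hN (i : ι) : ∫⁻ g, N g ∂((P i).map (X i)) ≤ M := by
    rw [lintegral_tsum fun ξ => ((hmeas ξ).const_mul _).aemeasurable]
    refine ENNReal.tsum_le_tsum fun ξ => ?_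
    rw [lintegral_const_mul _ (hmeas ξ), lintegral_map' (hmeas ξ).aemeasurable (hX i)]
    gcongr
    exact hD i ξ
  rw [isTightMeasureSet_iff_exists_isCompact_measure_compl_le]
  intro δ hδ
  obtain ⟨k, hk⟩ := ENNReal.exists_nat_mul_gt hδ.ne' hM
  have hk0 : (k : ENNReal) ≠ 0 := by
    rintro h
    simp [h] at hk
  refine ⟨{g | ∀ ξ, weight K a ξ * ‖g.coeff ξ‖ ≤ Real.sqrt (C * k * freqNorm ξ ^ (2 * a))},
    isCompact_cube ?_, ?_⟩
  · refine ((summable_freqNorm_rpow ha).mul_left (C * k)).congr fun ξ => ?_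
    rw [Real.sq_sqrt (mul_nonneg (by positivity) (hr ξ))]
  · rintro _ ⟨i, rfl⟩
    have hsub : {g : SobolevSpace K a | ∀ ξ, weight K a ξ * ‖g.coeff ξ‖ ≤
        Real.sqrt (C * k * freqNorm ξ ^ (2 * a))}ᶜ ⊆ {g | (k : ENNReal) ≤ N g} := by
      intro g hg
      by_contra hlt
      have hlt' : N g < k := not_le.mp hlt
      refine hg fun ξ => Real.le_sqrt_of_sq_le ?_
      have h1 : freqNorm ξ ^ (2 * a) * ‖g.coeff ξ‖ ^ 2 ≤ k := by
        have h2 := (ENNReal.le_tsum (f := fun ξ => ENNReal.ofReal (freqNorm ξ ^ (2 * a)) *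
          ENNReal.ofReal (‖g.coeff ξ‖ ^ 2)) ξ).trans hlt'.le
        rw [← ENNReal.ofReal_mul (hr ξ), ← ENNReal.ofReal_natCast,
          ENNReal.ofReal_le_ofReal_iff k.cast_nonneg] at h2
        exact h2
      calc (weight K a ξ * ‖g.coeff ξ‖) ^ 2
          = K ξ * (freqNorm ξ ^ (2 * a) * ‖g.coeff ξ‖ ^ 2) * freqNorm ξ ^ (2 * a) := by
            rw [weight, mul_pow, mul_pow, Real.sq_sqrt (K ξ).2.le]
            ring
        _ ≤ C * k * freqNorm ξ ^ (2 * a) := by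
            have := hK ξ
            have := hr ξ
            gcongr
    calc ((P i).map (X i)) _ ≤ ((P i).map (X i)) {g | (k : ENNReal) ≤ N g} := measure_mono hsub
      _ ≤ (∫⁻ g, N g ∂((P i).map (X i))) / k :=
          meas_ge_le_lintegral_div hNm.aemeasurable hk0 (ENNReal.natCast_ne_top k)
      _ ≤ δ := ENNReal.div_le_of_le_mul' ((hN i).trans hk.le)

end Tight

/-! ### Convergence of the covariances -/

section Limit

variable {d : ℕ}

theorem eventually_redFreq_eq_iff (ξ η : Fin d → ℤ) :
    ∀ᶠ n : ℕ+ in atTop, redFreq n ξ = redFreq n η ↔ ξ = η := by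
  by_cases h : ξ = η
  · simp [h]
  obtain ⟨i, hi⟩ := Function.ne_iff.mp h
  have hev : ∀ᶠ n : ℕ+ in atTop, (ξ i - η i).natAbs < n :=
    tendsto_PNat_val_atTop_atTop.eventually_gt_atTop _
  filter_upwards [hev] with n hn
  refine ⟨fun h' => absurd ?_ hi, fun h' => by rw [h']⟩
  have h1 := congrFun h' i
  rw [redFreq, redFreq, eq_comm, ZMod.intCast_eq_intCast_iff_dvd_sub] at h1
  have h2 := Int.eq_zero_of_abs_lt_dvd h1 (by rw [Int.abs_eq_natAbs]; omega)
  omega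

variable {K : (Fin d → ℤ) → Set.Ioi (0 : ℝ)} {a : ℝ} {Ω : ℕ+ → Type*} [∀ n, MeasurableSpace (Ω n)]
  {P : ∀ n, Measure (Ω n)} {Kn : ∀ n : ℕ+, DTorus d n → ℝ} {σ : ∀ n : ℕ+, Ω n → DTorus d n → ℝ}

/-- The covariances of the Fourier coefficients converge to those of the limiting field, for which
distinct frequencies are uncorrelated and the variance at `ξ` is `K̂(ξ) ‖ξ‖⁻⁴` (and `0` at `ξ = 0`, as
`0 ^ (-4) = 0`). Two distinct frequencies are uncorrelated as soon as they differ modulo `n`. -/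
theorem tendsto_integral_coeff_fieldMap (hd : 1 ≤ d) (hw : Summable fun ξ => weight K a ξ ^ 2)
    (hint : ∀ n x y, Integrable (fun ω => σ n ω x * σ n ω y) (P n))
    (hcov : ∀ n x y, ∫ ω, σ n ω x * σ n ω y ∂(P n) = Kn n (x - y))
    (hK : ∀ ξ, Tendsto (fun n => dft (Kn n) ξ) atTop (𝓝 ((K ξ : ℝ) : ℂ))) (ξ η : Fin d → ℤ) :
    Tendsto (fun n => ∫ ω, (fieldMap hd hw (σ n ω)).coeff ξ *
      (starRingEnd ℂ) ((fieldMap hd hw (σ n ω)).coeff η) ∂(P n)) atTop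
      (𝓝 (if ξ = η then ((K ξ * freqNorm ξ ^ (4 * (-1 : ℝ)) : ℝ) : ℂ) else 0)) := by
  by_cases hξ : ξ = 0
  · have h0 : freqNorm (0 : Fin d → ℤ) ^ (4 * (-1 : ℝ)) = 0 := by
      rw [freqNorm]
      norm_num
    simp only [hξ, h0, coeff_zero_freq, zero_mul, integral_zero, mul_zero, Complex.ofReal_zero,
      ite_self]
    exact tendsto_const_nhds
  by_cases hη : η = 0
  · simp [hη, hξ]
  simp only [integral_coeff_fieldMap hd hw (hint _) (hcov _) hξ hη]
  have h2 : Tendsto (fun n : ℕ+ => if redFreq n ξ = redFreq n η then dft (Kn n) ξ else 0) atTop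
      (𝓝 (if ξ = η then ((K ξ : ℝ) : ℂ) else 0)) := by
    have h3 : Tendsto (fun n : ℕ+ => if ξ = η then dft (Kn n) ξ else 0) atTop
        (𝓝 (if ξ = η then ((K ξ : ℝ) : ℂ) else 0)) := by
      split_ifs
      · exact hK ξ
      · exact tendsto_const_nhds
    refine h3.congr' ?_
    filter_upwards [eventually_redFreq_eq_iff ξ η] with n hn
    simp only [hn]
  have h := ((tendsto_multiplier hd hξ).mul
    ((Complex.continuous_conj.tendsto _).comp (tendsto_multiplier hd hη))).mul h2
  refine h.trans (le_of_eq ?_)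
  congr 1
  split_ifs with hξη
  · have hpow : freqNorm ξ ^ (4 * (-1 : ℝ)) = (freqNorm ξ ^ 2)⁻¹ * (freqNorm ξ ^ 2)⁻¹ := by
      have h0 : 0 ≤ freqNorm ξ := Real.sqrt_nonneg _
      rw [mul_neg_one, Real.rpow_neg h0, ← mul_inv, ← pow_add]
      norm_cast
    rw [← hξη, Complex.conj_ofReal, hpow]
    push_cast
    ring
  · rw [mul_zero]

/-- The pairing of a real series with a real trigonometric polynomial is real. -/
theorem ofReal_finPair {φ : SobolevSpace K (-1)} {T : Finset (Fin d → ℤ)}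
    (hT : ∀ ξ, ξ ∉ T → φ.coeff ξ = 0) (g : SobolevSpace K a) :
    ((finPair T φ.coeff g : ℝ) : ℂ) = ∑ ξ ∈ T, g.coeff ξ * (starRingEnd ℂ) (φ.coeff ξ) := by
  have hext : ∑ ξ ∈ T, g.coeff ξ * (starRingEnd ℂ) (φ.coeff ξ) =
      ∑ ξ ∈ symClosure T, g.coeff ξ * (starRingEnd ℂ) (φ.coeff ξ) :=
    Finset.sum_subset (subset_symClosure T) fun ξ _ hξ => by rw [hT ξ hξ, map_zero, mul_zero]
  have hconj : (starRingEnd ℂ) (∑ ξ ∈ T, g.coeff ξ * (starRingEnd ℂ) (φ.coeff ξ)) =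
      ∑ ξ ∈ T, g.coeff ξ * (starRingEnd ℂ) (φ.coeff ξ) := by
    rw [hext, map_sum, ← sum_symClosure_neg T fun ξ => g.coeff ξ * (starRingEnd ℂ) (φ.coeff ξ)]
    exact Finset.sum_congr rfl fun ξ _ => (mul_conj_neg g φ ξ).symm
  rw [finPair_apply, ← Complex.re_sum]
  exact Complex.conj_eq_iff_re.mp hconj

/-- The variance of the pairing with a trigonometric polynomial `φ` converges to the squared norm of `φ`
in `H_K^{-1}`. -/
theorem tendsto_integral_finPair_sq (hd : 1 ≤ d) (hw : Summable fun ξ => weight K a ξ ^ 2)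
    (hint : ∀ n x y, Integrable (fun ω => σ n ω x * σ n ω y) (P n))
    (hcov : ∀ n x y, ∫ ω, σ n ω x * σ n ω y ∂(P n) = Kn n (x - y))
    (hK : ∀ ξ, Tendsto (fun n => dft (Kn n) ξ) atTop (𝓝 ((K ξ : ℝ) : ℂ)))
    {φ : SobolevSpace K (-1)} {T : Finset (Fin d → ℤ)} (hT : ∀ ξ, ξ ∉ T → φ.coeff ξ = 0) :
    Tendsto (fun n => ∫ ω, finPair T φ.coeff (fieldMap hd hw (σ n ω)) ^ 2 ∂(P n)) atTop
      (𝓝 (‖φ‖ ^ 2)) := by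
  have hsq (g : SobolevSpace K a) : ((finPair T φ.coeff g ^ 2 : ℝ) : ℂ) =
      ∑ ξ ∈ T, ∑ η ∈ T, (starRingEnd ℂ) (φ.coeff ξ) * φ.coeff η *
        (g.coeff ξ * (starRingEnd ℂ) (g.coeff η)) := by
    have h1 : ((finPair T φ.coeff g ^ 2 : ℝ) : ℂ) = ((finPair T φ.coeff g : ℝ) : ℂ) *
        (starRingEnd ℂ) ((finPair T φ.coeff g : ℝ) : ℂ) := by
      rw [Complex.conj_ofReal]
      push_cast
      ring
    rw [h1, ofReal_finPair hT, map_sum, Finset.sum_mul_sum]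
    refine Finset.sum_congr rfl fun ξ _ => Finset.sum_congr rfl fun η _ => ?_
    rw [map_mul, Complex.conj_conj]
    ring
  have hE (n : ℕ+) : ((∫ ω, finPair T φ.coeff (fieldMap hd hw (σ n ω)) ^ 2 ∂(P n) : ℝ) : ℂ) =
      ∑ ξ ∈ T, ∑ η ∈ T, (starRingEnd ℂ) (φ.coeff ξ) * φ.coeff η *
        ∫ ω, (fieldMap hd hw (σ n ω)).coeff ξ *
          (starRingEnd ℂ) ((fieldMap hd hw (σ n ω)).coeff η) ∂(P n) := by
    have hi (ξ η : Fin d → ℤ) := (integrable_coeff_fieldMap hd hw (hint n) ξ η).const_mul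
      ((starRingEnd ℂ) (φ.coeff ξ) * φ.coeff η)
    rw [← integral_complex_ofReal]
    simp only [hsq]
    rw [integral_finsetSum _ fun ξ _ => integrable_finsetSum _ fun η _ => hi ξ η]
    refine Finset.sum_congr rfl fun ξ _ => ?_
    rw [integral_finsetSum _ fun η _ => hi ξ η]
    simp only [integral_const_mul]
  have hlim := tendsto_finsetSum T fun ξ _ => tendsto_finsetSum T fun η _ =>
    (tendsto_integral_coeff_fieldMap hd hw hint hcov hK ξ η).const_mul
      ((starRingEnd ℂ) (φ.coeff ξ) * φ.coeff η)
  have hnorm : ∑ ξ ∈ T, ∑ η ∈ T, (starRingEnd ℂ) (φ.coeff ξ) * φ.coeff η *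
      (if ξ = η then ((K ξ * freqNorm ξ ^ (4 * (-1 : ℝ)) : ℝ) : ℂ) else 0) =
      ((‖φ‖ ^ 2 : ℝ) : ℂ) := by
    rw [norm_sq_eq_sum hT, Complex.ofReal_sum]
    refine Finset.sum_congr rfl fun ξ hξ => ?_
    simp only [mul_ite, mul_zero, Finset.sum_ite_eq, if_pos hξ]
    rw [Complex.ofReal_mul _ (‖φ.coeff ξ‖ ^ 2), Complex.ofReal_pow, ← Complex.conj_mul', mul_comm]
  rw [hnorm] at hlim
  have h := (Complex.continuous_re.tendsto _).comp hlim
  rw [Complex.ofReal_re] at h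
  refine h.congr fun n => ?_
  rw [Function.comp_apply, ← hE, Complex.ofReal_re]

end Limit

end Sandpile

namespace Sandpile

/-! ### Convergence in law -/

open SobolevSpace

theorem integrable_mul_of_hasGaussianLaw {ι Ω : Type*} [Finite ι] [MeasurableSpace Ω] {P : Measure Ω}
    {σ : Ω → ι → ℝ} (hσ : HasGaussianLaw σ P) (x y : ι) :
    Integrable (fun ω => σ ω x * σ ω y) P :=
  (HasGaussianLaw.eval (X := fun x ω => σ ω x) hσ x).memLp_two.integrable_mul
    (HasGaussianLaw.eval (X := fun x ω => σ ω x) hσ y).memLp_two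

section GaussianField

variable {d n : ℕ} [NeZero n] {K : (Fin d → ℤ) → Set.Ioi (0 : ℝ)} {a : ℝ} {Ω : Type*}
  [MeasurableSpace Ω] {P : Measure Ω} {σ : Ω → DTorus d n → ℝ}

theorem hasGaussianLaw_fieldMap (hd : 1 ≤ d) (hw : Summable fun ξ => weight K a ξ ^ 2)
    (hσ : HasGaussianLaw σ P) : HasGaussianLaw (fun ω => fieldMap hd hw (σ ω)) P :=
  hσ.map_fun (⟨fieldMap hd hw, continuous_fieldMap hd hw⟩ : (DTorus d n → ℝ) →L[ℝ] SobolevSpace K a)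

theorem charFunDual_map_fieldMap (hd : 1 ≤ d) (hw : Summable fun ξ => weight K a ξ ^ 2)
    (hσ : HasGaussianLaw σ P) (hmean : ∀ x, ∫ ω, σ ω x ∂P = 0) (L : SobolevSpace K a →L[ℝ] ℝ) :
    charFunDual (P.map fun ω => fieldMap hd hw (σ ω)) L =
      (Real.exp (-(∫ ω, L (fieldMap hd hw (σ ω)) ^ 2 ∂P) / 2) : ℂ) := by
  have hX := hasGaussianLaw_fieldMap hd hw hσ
  have h0 : ∫ ω, L (fieldMap hd hw (σ ω)) ∂P = 0 := by
    let M : (DTorus d n → ℝ) →L[ℝ] ℝ :=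
      L.comp ⟨fieldMap hd hw, continuous_fieldMap hd hw⟩
    have h1 : ∫ ω, M (σ ω) ∂P = M (∫ ω, σ ω ∂P) := M.integral_comp_comm hσ.integrable
    have h2 : ∫ ω, σ ω ∂P = 0 := funext fun x => by
      rw [eval_integral fun y => (HasGaussianLaw.eval (X := fun x ω => σ ω x) hσ y).integrable,
        hmean, Pi.zero_apply]
    rw [h2, map_zero] at h1
    exact h1
  have hm : AEMeasurable (fun ω => L (fieldMap hd hw (σ ω))) P :=
    L.measurable.comp_aemeasurable hX.aemeasurable
  rw [hX.charFunDual_map_eq_fun, h0, variance_of_integral_eq_zero hm h0, Complex.ofReal_zero,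
    zero_mul, zero_sub, neg_div, Complex.ofReal_exp]
  push_cast
  rfl

end GaussianField

section Convergence

/-- The characteristic function of a functional converges along every weakly convergent family. -/
theorem tendsto_charFunDual {E ι : Type*} [NormedAddCommGroup E] [NormedSpace ℝ E]
    [MeasurableSpace E] [BorelSpace E] {l : Filter ι} {ν : ι → ProbabilityMeasure E}
    {μ : ProbabilityMeasure E} (h : Tendsto ν l (𝓝 μ)) (L : E →L[ℝ] ℝ) :
    Tendsto (fun i => charFunDual (ν i : Measure E) L) l (𝓝 (charFunDual (μ : Measure E) L)) := by
  let f : BoundedContinuousFunction E ℂ :=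
    BoundedContinuousFunction.ofNormedAddCommGroup (fun g => Complex.exp (L g * Complex.I))
      (by fun_prop) 1 fun g => (Complex.norm_exp_ofReal_mul_I _).le
  have h1 := (ProbabilityMeasure.tendsto_iff_forall_integral_rclike_tendsto ℂ).mp h f
  simp only [charFunDual_apply]
  exact h1

variable {d : ℕ} {K : (Fin d → ℤ) → Set.Ioi (0 : ℝ)} {a : ℝ} {Ω : ℕ+ → Type*}
  [∀ n, MeasurableSpace (Ω n)] {P : ∀ n, Measure (Ω n)} {Kn : ∀ n : ℕ+, DTorus d n → ℝ}
  {σ : ∀ n : ℕ+, Ω n → DTorus d n → ℝ}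

/-- Every weak limit point of the laws of the rescaled odometers is Gaussian and has the marginals of
the limiting field. -/
theorem isGaussian_and_hasFieldMarginals_of_tendsto (hd : 1 ≤ d)
    (hw : Summable fun ξ => weight K a ξ ^ 2) (hσ : ∀ n, HasGaussianLaw (σ n) (P n))
    (hmean : ∀ n x, ∫ ω, σ n ω x ∂(P n) = 0)
    (hcov : ∀ n x y, ∫ ω, σ n ω x * σ n ω y ∂(P n) = Kn n (x - y))
    (hK : ∀ ξ, Tendsto (fun n => dft (Kn n) ξ) atTop (𝓝 ((K ξ : ℝ) : ℂ)))
    {ν : ℕ+ → ProbabilityMeasure (SobolevSpace K a)}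
    (hν : ∀ n, (ν n : Measure (SobolevSpace K a)) = (P n).map fun ω => fieldMap hd hw (σ n ω))
    {l : Filter ℕ+} [l.NeBot] (hl : l ≤ atTop) {μ : ProbabilityMeasure (SobolevSpace K a)}
    (hμ : Tendsto ν l (𝓝 μ)) :
    IsGaussian (μ : Measure (SobolevSpace K a)) ∧
      HasFieldMarginals (μ : Measure (SobolevSpace K a)) := by
  have hint (n : ℕ+) := integrable_mul_of_hasGaussianLaw (hσ n)
  have hchar (L : SobolevSpace K a →L[ℝ] ℝ) : Tendsto (fun n : ℕ+ =>
      (Real.exp (-(∫ ω, L (fieldMap hd hw (σ n ω)) ^ 2 ∂(P n)) / 2) : ℂ)) l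
      (𝓝 (charFunDual (μ : Measure (SobolevSpace K a)) L)) := by
    refine (tendsto_charFunDual hμ L).congr fun n => ?_
    rw [hν, charFunDual_map_fieldMap hd hw (hσ n) (hmean n)]
  refine ⟨isGaussian_of_tendsto_charFunDual
    (V := fun n L => ∫ ω, L (fieldMap hd hw (σ n ω)) ^ 2 ∂(P n)) (fun n L t => ?_) hchar,
    fun φ T hT => ?_⟩
  · simp only [smul_apply, smul_eq_mul, mul_pow, integral_const_mul]
  · have h1 := (tendsto_integral_finPair_sq hd hw hint hcov hK hT).mono_left hl
    refine tendsto_nhds_unique (hchar (finPair T φ.coeff)) ?_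
    exact (Complex.continuous_ofReal.tendsto _).comp
      ((Real.continuous_exp.tendsto _).comp (h1.neg.div_const 2))

end Convergence

end Sandpile

theorem theorem1 {d : ℕ} (hd : 1 ≤ d)
    {Ω : ℕ+ → Type*} [∀ n, MeasurableSpace (Ω n)]
    (P : ∀ n, Measure (Ω n)) [∀ n, IsProbabilityMeasure (P n)]
    (Kn : ∀ n : ℕ+, DTorus d n → ℝ)
    (σ : ∀ n : ℕ+, Ω n → DTorus d n → ℝ)
    (hσ_gauss : ∀ n, HasGaussianLaw (σ n) (P n))
    (hσ_mean : ∀ n x, ∫ ω, σ n ω x ∂(P n) = 0)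
    (hσ_cov : ∀ n x y, ∫ ω, σ n ω x * σ n ω y ∂(P n) = Kn n (x - y))
    (K : (Fin d → ℤ) → Set.Ioi (0 : ℝ))
    (hK_bdd : ∃ C : ℝ, ∀ n ξ, ‖dft (Kn n) ξ‖ ≤ C)
    (hK_lim : ∀ ξ, Tendsto (fun n => dft (Kn n) ξ) atTop (𝓝 ((K ξ : ℝ) : ℂ)))
    (ε : ℝ) (hε : max ((d : ℝ) / 2) ((d : ℝ) / 4 + 1) < ε) :
    (∀ n ω x, odometer (initialConfig (σ n ω)) x ≠ ⊤) ∧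
    ∃ X : ∀ n : ℕ+, Ω n → SobolevSpace K (-ε),
      (∀ n ω, (X n ω).Represents (scaledField (σ n ω))) ∧
      ∃ μ : ProbabilityMeasure (SobolevSpace K (-ε)),
        IsLimitLaw (μ : Measure (SobolevSpace K (-ε))) ∧
        (∀ ν : ProbabilityMeasure (SobolevSpace K (-ε)),
          IsLimitLaw (ν : Measure (SobolevSpace K (-ε))) → ν = μ) ∧
        TendstoInDistribution X atTop id P (μ : Measure (SobolevSpace K (-ε))) := by
  refine ⟨fun n ω x => odometer_ne_top hd (sum_initialConfig _) x, ?_⟩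
  obtain ⟨C, hC⟩ := hK_bdd
  have hε2 : (d : ℝ) / 2 < ε := (le_max_left _ _).trans_lt hε
  have hd0 : (0 : ℝ) ≤ d := Nat.cast_nonneg d
  have hKC (ξ : Fin d → ℤ) : (K ξ : ℝ) ≤ C := by
    have h := le_of_tendsto' (hK_lim ξ).norm fun n => hC n ξ
    rw [Complex.norm_real] at h
    exact (Real.le_norm_self _).trans h
  have hw : Summable fun ξ => weight K (-ε) ξ ^ 2 := summable_weight_sq hKC (by linarith)
  let X (n : ℕ+) (ω : Ω n) : SobolevSpace K (-ε) := fieldMap hd hw (σ n ω)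
  have hX (n : ℕ+) : AEMeasurable (X n) (P n) :=
    (hasGaussianLaw_fieldMap hd hw (hσ_gauss n)).aemeasurable
  let ν (n : ℕ+) : ProbabilityMeasure (SobolevSpace K (-ε)) :=
    ⟨(P n).map (X n), Measure.isProbabilityMeasure_map (hX n)⟩
  have hint (n : ℕ+) := integrable_mul_of_hasGaussianLaw (hσ_gauss n)
  have hcompact : IsCompact (closure (Set.range ν)) := by
    refine isCompact_closure_of_isTightMeasureSet
      ((isTightMeasureSet_of_lintegral_le hX hKC (by linarith) fun n ξ =>
        lintegral_enorm_coeff_fieldMap_le hd hw (hint n) (hσ_cov n) (hC n) ξ).subset ?_)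
    rintro _ ⟨_, ⟨n, rfl⟩, rfl⟩
    exact ⟨n, rfl⟩
  -- every ultrafilter tending to infinity has a limit law, which its marginals determine
  have hlim (U : Ultrafilter ℕ+) : ∃ μ, Tendsto ν U (𝓝 μ) := by
    obtain ⟨μ, -, hμ⟩ := hcompact.ultrafilter_le_nhds (U.map ν)
      (le_principal_iff.mpr (Filter.mem_map.mpr (Filter.univ_mem' fun n =>
        subset_closure (Set.mem_range_self n))))
    exact ⟨μ, hμ⟩
  have hprop {U : Ultrafilter ℕ+} (hU : (U : Filter ℕ+) ≤ atTop)
      {μ : ProbabilityMeasure (SobolevSpace K (-ε))} (hμ : Tendsto ν U (𝓝 μ)) :=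
    isGaussian_and_hasFieldMarginals_of_tendsto hd hw hσ_gauss hσ_mean hσ_cov hK_lim
      (fun _ => rfl) hU hμ
  obtain ⟨μ, hμ⟩ := hlim (Ultrafilter.of atTop)
  obtain ⟨hgauss, hmarg⟩ := hprop (Ultrafilter.of_le atTop) hμ
  have htend : Tendsto ν atTop (𝓝 μ) := by
    rw [tendsto_iff_ultrafilter]
    intro U hU
    obtain ⟨μ', hμ'⟩ := hlim U
    have : μ' = μ := ProbabilityMeasure.toMeasure_injective ((hprop hU hμ').2.eq hmarg)
    rwa [this] at hμ'
  refine ⟨X, fun n ω => represents_fieldMap hd hw _, μ,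
    ⟨hgauss, fun f => hmarg.exists_isPairing f⟩,
    fun μ' hμ' => ProbabilityMeasure.toMeasure_injective (hμ'.hasFieldMarginals.eq hmarg),
    ⟨hX, aemeasurable_id, ?_⟩⟩
  have hid : (⟨Measure.map id (μ : Measure (SobolevSpace K (-ε))),
      Measure.isProbabilityMeasure_map aemeasurable_id⟩ : ProbabilityMeasure _) = μ :=
    ProbabilityMeasure.toMeasure_injective Measure.map_id
  rw [hid]
  exact htend
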